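/- Let $(M,g)$ be a smooth time-oriented $4$-dimensional Lorentzian manifold of signature $(-,+,+,+)$ satisfying the null convergence condition $\mathrm{Ric}(X,X)\ge 0$ for every null vector $X$. For a spacelike surface $\Sigma$ with induced Riemannian metric $\gamma$ and a null normal vector field $K$ on it, let $\chi_K(X,Y)=g(\nabla_XK,Y)$ ($X,Y$ tangent to $\Sigma$) be the null second fundamental form, $\operatorname{tr}\chi_K$ (trace with respect to $\gamma$) the null expansion, and $\hat\chi_K=\chi_K-\tfrac12(\operatorname{tr}\chi_K)\,\gamma$ the shear. A marginal tube is a smooth (immersed) hypersurface $\mathcal H\subset M$ with a smooth foliation by spacelike surfaces, such that there is a continuous future null direction normal to the leaves along $\mathcal H$ with respect to which the null expansion of every leaf vanishes identically. A tangential null marginal tube is a marginal tube $\mathcal H$ that is a null hypersurface (its induced metric is degenerate at every point) and such that, for its smooth future-directed null tangent vector field $L=L_{\mathcal H}$, the null expansion $\operatorname{tr}\chi_L$ of every leaf vanishes identically. Then every tangential null marginal tube $\mathcal H$ in $M$ is shear-free: $\hat\chi_L=0$ at every point of every spacelike section of $\mathcal H$ (a spacelike surface contained in $\mathcal H$), in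 particular on the leaves of the foliation. -/

import Mathlib

open scoped Manifold ContDiff Topology

noncomputable section

local notation "ℝ⁴" => EuclideanSpace ℝ (Fin 4)

namespace NullTube

section Metric

variable (M : Type*) [TopologicalSpace M] [ChartedSpace ℝ⁴ M] [IsManifold (𝓡 4) ∞ M]

/-- A smooth Lorentzian metric of signature `(-,+,+,+)` on a smooth 4-manifold. -/
structure LorentzianMetric where
  /-- The metric as a bilinear form on each tangent space. -/
  inner (x : M) : TangentSpace (𝓡 4) x →L[ℝ] TangentSpace (𝓡 4) x →L[ℝ] ℝ
  symm (x : M) (v w : TangentSpace (𝓡 4) x) : inner x v w = inner x w v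
  exists_frame (x : M) : ∃ b : Module.Basis (Fin 4) ℝ (TangentSpace (𝓡 4) x),
    ∀ i j, inner x (b i) (b j) = if i = j then (if i = 0 then -1 else 1) else 0
  contMDiff : ContMDiff (𝓡 4) ((𝓡 4).prod 𝓘(ℝ, ℝ⁴ →L[ℝ] ℝ⁴ →L[ℝ] ℝ)) ∞
    (fun x ↦ Bundle.TotalSpace.mk' (ℝ⁴ →L[ℝ] ℝ⁴ →L[ℝ] ℝ)
      (E := fun x : M ↦ TangentSpace (𝓡 4) x →L[ℝ] TangentSpace (𝓡 4) x →L[ℝ] ℝ) x (inner x))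

end Metric

section Geometry

variable {M : Type*} [TopologicalSpace M] [ChartedSpace ℝ⁴ M] [IsManifold (𝓡 4) ∞ M]

/-- A time orientation: a continuous timelike vector field, declared to be future directed. -/
structure TimeOrientation (g : LorentzianMetric M) where
  /-- The timelike vector field. -/
  field (x : M) : TangentSpace (𝓡 4) x
  timelike (x : M) : g.inner x (field x) (field x) < 0
  continuous : Continuous (fun x ↦ (⟨x, field x⟩ : TangentBundle (𝓡 4) M))

/-- A nonzero null vector. -/
def LorentzianMetric.IsNull (g : LorentzianMetric M) (x : M) (v : TangentSpace (𝓡 4) x) : Prop :=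
  v ≠ 0 ∧ g.inner x v v = 0

/-- A future directed null vector. -/
def TimeOrientation.IsFutureNull {g : LorentzianMetric M} (τ : TimeOrientation g) (x : M)
    (v : TangentSpace (𝓡 4) x) : Prop :=
  g.IsNull x v ∧ g.inner x (τ.field x) v < 0

/-- The coordinates, in the chart around `c`, of tangent vectors at `x`. -/
def toCoord (c x : M) : TangentSpace (𝓡 4) x →L[ℝ] ℝ⁴ :=
  mfderiv (𝓡 4) 𝓘(ℝ, ℝ⁴) (extChartAt (𝓡 4) c) x

/-- The tangent vector with given coordinates in the chart around `c`, at the coordinate point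
`y`. -/
def ofCoord (c : M) (y : ℝ⁴) : ℝ⁴ →L[ℝ] TangentSpace (𝓡 4) ((extChartAt (𝓡 4) c).symm y) :=
  mfderiv 𝓘(ℝ, ℝ⁴) (𝓡 4) (extChartAt (𝓡 4) c).symm y

/-- The matrix of the metric in the chart around `c`, at the coordinate point `y`, as the bilinear
form `(u, v) ↦ g_{ij}(y) uⁱ vʲ` on `ℝ⁴`. -/
def LorentzianMetric.coord (g : LorentzianMetric M) (c : M) (y : ℝ⁴) : ℝ⁴ →L[ℝ] ℝ⁴ →L[ℝ] ℝ :=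
  (ContinuousLinearMap.precomp ℝ (ofCoord c y)).comp
    ((g.inner ((extChartAt (𝓡 4) c).symm y)).comp (ofCoord c y))

/-- The Christoffel symbols of the Levi-Civita connection in the chart around `c`, as the vector
`Γᵏ_{ij}(y) uⁱ vʲ`, where
`g_{lk} Γᵏ_{ij} = (∂_i g_{jl} + ∂_j g_{il} - ∂_l g_{ij}) / 2`. -/
def LorentzianMetric.christoffel (g : LorentzianMetric M) (c : M) (y : ℝ⁴) (u v : ℝ⁴) : ℝ⁴ :=
  let D : ℝ⁴ →L[ℝ] ℝ⁴ →L[ℝ] ℝ⁴ →L[ℝ] ℝ := fderiv ℝ (g.coord c) y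
  (g.coord c y).inverse ((1 / 2 : ℝ) • (D u v + D v u - (D.flip u).flip v))

/-- The Riemann curvature `R(u,v)w = ∇_u ∇_v w - ∇_v ∇_u w - ∇_{[u,v]} w`
in the chart around `c`. -/
def LorentzianMetric.riemannCoord (g : LorentzianMetric M) (c : M) (y : ℝ⁴) (u v w : ℝ⁴) : ℝ⁴ :=
  fderiv ℝ (fun y' ↦ g.christoffel c y' v w) y u - fderiv ℝ (fun y' ↦ g.christoffel c y' u w) y v
    + g.christoffel c y u (g.christoffel c y v w) - g.christoffel c y v (g.christoffel c y u w)

/-- The Ricci curvature `Ric(v,w) = tr (u ↦ R(u,v)w)`, computed in the chart around `x`. -/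
def LorentzianMetric.ricci (g : LorentzianMetric M) (x : M) (v w : TangentSpace (𝓡 4) x) : ℝ :=
  ∑ i : Fin 4, g.riemannCoord x (extChartAt (𝓡 4) x x) (EuclideanSpace.single i 1)
    (toCoord x x v) (toCoord x x w) i

/-- The null convergence condition: `Ric(X,X) ≥ 0` for all null vectors `X`. -/
def LorentzianMetric.NullConvergence (g : LorentzianMetric M) : Prop :=
  ∀ (x : M) (v : TangentSpace (𝓡 4) x), g.IsNull x v → 0 ≤ g.ricci x v v

variable {k : ℕ} {N : Type*} [TopologicalSpace N] [ChartedSpace (EuclideanSpace ℝ (Fin k)) N]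

/-- The Levi-Civita covariant derivative `∇_X V` at `p` of a vector field `V` along a map
`φ : N → M`, computed in the chart around `φ p`: its coordinates are
`X(Vᵏ) + Γᵏ_{ij} (dφ X)ⁱ Vʲ`. -/
def LorentzianMetric.covDerivAlong (g : LorentzianMetric M) (φ : N → M)
    (V : ∀ q : N, TangentSpace (𝓡 4) (φ q)) (p : N) (X : TangentSpace (𝓡 k) p) :
    TangentSpace (𝓡 4) (φ p) :=
  let c : M := φ p
  let y : ℝ⁴ := extChartAt (𝓡 4) c c
  let dV : TangentSpace (𝓡 k) p →L[ℝ] ℝ⁴ :=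
    mfderiv (𝓡 k) 𝓘(ℝ, ℝ⁴) (fun q ↦ toCoord c (φ q) (V q)) p
  ofCoord c y (dV X +
    g.christoffel c y (toCoord c (φ p) (mfderiv (𝓡 k) (𝓡 4) φ p X)) (toCoord c (φ p) (V p)))

/-- The metric induced by `φ : N → M`. -/
def LorentzianMetric.induced (g : LorentzianMetric M) (φ : N → M) (p : N)
    (X Y : TangentSpace (𝓡 k) p) : ℝ :=
  g.inner (φ p) (mfderiv (𝓡 k) (𝓡 4) φ p X) (mfderiv (𝓡 k) (𝓡 4) φ p Y)

/-- The null second fundamental form `χ(X,Y) = g(∇_X K, Y)` in the direction of the null field `K`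
along `φ`. -/
def LorentzianMetric.nullForm (g : LorentzianMetric M) (φ : N → M)
    (K : ∀ q : N, TangentSpace (𝓡 4) (φ q)) (p : N) (X Y : TangentSpace (𝓡 k) p) : ℝ :=
  g.inner (φ p) (g.covDerivAlong φ K p X) (mfderiv (𝓡 k) (𝓡 4) φ p Y)

/-- `(e 0, e 1)` is an orthonormal frame of a spacelike plane tangent to `φ` at `p`. -/
def LorentzianMetric.IsSpacelikeFrame (g : LorentzianMetric M) (φ : N → M) (p : N)
    (e : Fin 2 → TangentSpace (𝓡 k) p) : Prop :=
  ∀ A B, g.induced φ p (e A) (e B) = if A = B then 1 else 0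

/-- The null expansion `tr χ` with respect to `K` of a spacelike surface whose tangent plane has
the orthonormal frame `e`. -/
def LorentzianMetric.nullExpansion (g : LorentzianMetric M) (φ : N → M)
    (K : ∀ q : N, TangentSpace (𝓡 4) (φ q)) (p : N) (e : Fin 2 → TangentSpace (𝓡 k) p) : ℝ :=
  ∑ A, g.nullForm φ K p (e A) (e A)

/-- The components of the shear `χ̂ = χ - (1/2) (tr χ) g̸` with respect to `K` of a spacelike
surface whose tangent plane has the orthonormal frame `e`. -/
def LorentzianMetric.shear (g : LorentzianMetric M) (φ : N → M)
    (K : ∀ q : N, TangentSpace (𝓡 4) (φ q)) (p : N) (e : Fin 2 → TangentSpace (𝓡 k) p)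
    (A B : Fin 2) : ℝ :=
  g.nullForm φ K p (e A) (e B) - 1 / 2 * g.nullExpansion φ K p e * g.induced φ p (e A) (e B)

end Geometry

section Tube

/-- A smooth foliation of a 3-manifold by surfaces, through the tangent planes of its leaves:
locally the leaves are the level sets of a smooth submersion to `ℝ`. -/
structure Foliation (N : Type*) [TopologicalSpace N]
    [ChartedSpace (EuclideanSpace ℝ (Fin 3)) N] where
  /-- The tangent plane at `p` of the leaf through `p`. -/
  leafTangent (p : N) : Submodule ℝ (TangentSpace (𝓡 3) p)
  exists_submersion (p : N) : ∃ U : Set N, IsOpen U ∧ p ∈ U ∧ ∃ f : N → ℝ,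
    ContMDiffOn (𝓡 3) 𝓘(ℝ, ℝ) ∞ f U ∧
    ∀ q ∈ U, mfderiv (𝓡 3) 𝓘(ℝ, ℝ) f q ≠ 0 ∧
      leafTangent q = LinearMap.ker (mfderiv (𝓡 3) 𝓘(ℝ, ℝ) f q).toLinearMap

variable {M : Type*} [TopologicalSpace M] [ChartedSpace ℝ⁴ M] [IsManifold (𝓡 4) ∞ M]
  {N : Type*} [TopologicalSpace N] [ChartedSpace (EuclideanSpace ℝ (Fin 3)) N]

/-- The (immersed) hypersurface `ι : N → M`, with the foliation `F`, is a marginal tube: the leaves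
are spacelike, and there is a continuous future null direction `K`, normal to the leaves, with
respect to which the null expansion of every leaf vanishes at all of its points. Since only the
direction of `K` matters and `K` is only continuous, the expansion is computed from a smooth local
positive multiple of `K`. -/
structure IsMarginalTube {g : LorentzianMetric M} (τ : TimeOrientation g) (ι : N → M)
    (F : Foliation N) : Prop where
  smooth : ContMDiff (𝓡 3) (𝓡 4) ∞ ι
  immersion (p : N) : Function.Injective (mfderiv (𝓡 3) (𝓡 4) ι p)
  spacelike_leaf (p : N) (X : TangentSpace (𝓡 3) p) : X ∈ F.leafTangent p → X ≠ 0 →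
    0 < g.induced ι p X X
  marginal : ∃ K : ∀ p : N, TangentSpace (𝓡 4) (ι p),
    Continuous (fun p ↦ (⟨ι p, K p⟩ : TangentBundle (𝓡 4) M)) ∧
    ∀ p : N, τ.IsFutureNull (ι p) (K p) ∧
      (∀ X ∈ F.leafTangent p, g.inner (ι p) (K p) (mfderiv (𝓡 3) (𝓡 4) ι p X) = 0) ∧
      ∃ K' : ∀ q : N, TangentSpace (𝓡 4) (ι q),
        ContMDiffAt (𝓡 3) (𝓡 4).tangent ∞
          (fun q ↦ (⟨ι q, K' q⟩ : TangentBundle (𝓡 4) M)) p ∧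
        (∀ᶠ q in 𝓝 p, ∃ c : ℝ, 0 < c ∧ K' q = c • K q) ∧
        ∀ e : Fin 2 → TangentSpace (𝓡 3) p, (∀ A, e A ∈ F.leafTangent p) →
          g.IsSpacelikeFrame ι p e → g.nullExpansion ι K' p e = 0

/-- The hypersurface `ι : N → M` is null: its induced metric is degenerate everywhere. -/
def IsNullHypersurface (g : LorentzianMetric M) (ι : N → M) : Prop :=
  ∀ p : N, ∃ X : TangentSpace (𝓡 3) p, X ≠ 0 ∧ ∀ Y, g.induced ι p X Y = 0

/-- A vector field `L` on `N`, pushed forward to a vector field along `ι`. -/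
def push (ι : N → M) (L : ∀ p : N, TangentSpace (𝓡 3) p) (p : N) : TangentSpace (𝓡 4) (ι p) :=
  mfderiv (𝓡 3) (𝓡 4) ι p (L p)

/-- The marginal tube `ι : N → M` is a tangential null marginal tube with tangential future null
vector field `L`: it is null, and the null expansion of its leaves with respect to `L` vanishes. -/
structure IsTangentialNullMarginalTube [IsManifold (𝓡 3) ∞ N] {g : LorentzianMetric M}
    (τ : TimeOrientation g) (ι : N → M) (F : Foliation N)
    (L : ∀ p : N, TangentSpace (𝓡 3) p) : Prop where
  marginalTube : IsMarginalTube τ ι F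
  null : IsNullHypersurface g ι
  smooth : ContMDiff (𝓡 3) (𝓡 3).tangent ∞ (fun p ↦ (⟨p, L p⟩ : TangentBundle (𝓡 3) N))
  futureNull (p : N) : τ.IsFutureNull (ι p) (push ι L p)
  expansion (p : N) (e : Fin 2 → TangentSpace (𝓡 3) p) : (∀ A, e A ∈ F.leafTangent p) →
    g.IsSpacelikeFrame ι p e → g.nullExpansion ι (push ι L) p e = 0

/-- The hypersurface `ι : N → M` is shear-free with respect to `L`: at every point, the shear `χ̂`
vanishes on every spacelike plane tangent to the hypersurface, that is, for every spacelike section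
and in particular for the leaves of any foliation by spacelike surfaces. -/
def IsShearFree (g : LorentzianMetric M) (ι : N → M) (L : ∀ p : N, TangentSpace (𝓡 3) p) : Prop :=
  ∀ (p : N) (e : Fin 2 → TangentSpace (𝓡 3) p), g.IsSpacelikeFrame ι p e →
    ∀ A B, g.shear ι (push ι L) p e A B = 0

end Tube

end NullTube

end

noncomputable section

set_option maxSynthPendingDepth 3

/-! On a null hypersurface the null tangent field `L` is orthogonal to every tangent vector.
Differentiating g(L, W) = 0 shows that χ(U, W) = g(∇_U L, W) is symmetric and annihilates `L`;
equivalently, 2χ is the Lie derivative along `L` of the induced metric. So χ descends to the tangent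
space modulo `L`, and its trace is the same on all spacelike planes tangent at a point. Vanishing
expansion of the leaves therefore gives tr χ = 0 on every spacelike section.

The symmetry of χ also gives ∇_L L = κL. Commuting covariant derivatives yields a Riccati equation
for χ along `L` (`IsNullGerm.fderiv_coordForm`), whose trace is Raychaudhuri's equation L(tr χ) = κ
tr χ - |χ|² - Ric(L, L). With tr χ = 0 this leaves Ric(L, L) = -|χ|²
(`IsTangentialNullMarginalTube.ricci_eq`). Null convergence makes the left side nonnegative, so χ =
0, and with it the shear.

Two devices keep the computation elementary. First, no orthonormal frame is transported along `L`:
tr χ = 0 is rewritten as the identity h(v,v) χ(u,u) - 2 h(u,v) χ(u,v) + h(u,u) χ(v,v) = 0 for all u,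
v, where h is the induced metric (`IsDegenerateFrame.polarized_trace`), and this can be
differentiated with u, v constant in a chart. Second, `covDerivAlong` uses a chart that moves with
the point, whereas differentiation needs a fixed one; since χ is determined by h and `L`, it does
not depend on the target chart (`IsNullGerm.coordForm_congr`), so no transformation law for
Christoffel symbols is needed. -/

namespace NullTube

/-! ### Covariant derivatives along a map and curvature, in coordinates. -/

section Calculus

variable {E F : Type*} [NormedAddCommGroup E] [NormedSpace ℝ E] [NormedAddCommGroup F]
  [NormedSpace ℝ F]

/-- The covariant derivative, in coordinates, of a vector field `V` along a map `φ`, for the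
connection with Christoffel symbols `Γ`. -/
def covAlong (Γ : F → F →L[ℝ] F →L[ℝ] F) (φ V : E → F) (x u : E) : F :=
  fderiv ℝ V x u + Γ (φ x) (fderiv ℝ φ x u) (V x)

/-- The curvature, in coordinates, of the connection with Christoffel symbols `Γ`. -/
def curvature (Γ : F → F →L[ℝ] F →L[ℝ] F) (y u v w : F) : F :=
  fderiv ℝ (fun y' ↦ Γ y' v w) y u - fderiv ℝ (fun y' ↦ Γ y' u w) y v
    + Γ y u (Γ y v w) - Γ y v (Γ y u w)

/-- Compatibility of the connection `Γ` with the metric `G` at `y`. -/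
def MetricCompatible (G : F → F →L[ℝ] F →L[ℝ] ℝ) (Γ : F → F →L[ℝ] F →L[ℝ] F) (y : F) : Prop :=
  ∀ a b c, fderiv ℝ G y a b c = G y (Γ y a b) c + G y b (Γ y a c)

lemma fderiv_clm_apply₂ {H : Type*} [NormedAddCommGroup H] [NormedSpace ℝ H]
    {T : E → F →L[ℝ] F →L[ℝ] H} {V W : E → F} {x : E}
    (hT : DifferentiableAt ℝ T x) (hV : DifferentiableAt ℝ V x) (hW : DifferentiableAt ℝ W x)
    (u : E) :
    fderiv ℝ (fun x ↦ T x (V x) (W x)) x u =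
      fderiv ℝ T x u (V x) (W x) + T x (fderiv ℝ V x u) (W x) + T x (V x) (fderiv ℝ W x u) := by
  rw [fderiv_clm_apply (hT.clm_apply hV) hW, fderiv_clm_apply hT hV]
  simp
  abel

lemma covAlong_add (Γ : F → F →L[ℝ] F →L[ℝ] F) (φ V : E → F) (x u v : E) :
    covAlong Γ φ V x (u + v) = covAlong Γ φ V x u + covAlong Γ φ V x v := by
  simp only [covAlong, map_add, add_apply]
  abel

lemma covAlong_smul (Γ : F → F →L[ℝ] F →L[ℝ] F) (φ V : E → F) (x : E) (c : ℝ) (u : E) :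
    covAlong Γ φ V x (c • u) = c • covAlong Γ φ V x u := by
  simp only [covAlong, map_smul, smul_apply, smul_add]

lemma fderiv_metric {G : F → F →L[ℝ] F →L[ℝ] ℝ} {Γ : F → F →L[ℝ] F →L[ℝ] F} {φ V W : E → F}
    {x : E} (hG : DifferentiableAt ℝ G (φ x)) (hc : MetricCompatible G Γ (φ x))
    (hφ : DifferentiableAt ℝ φ x) (hV : DifferentiableAt ℝ V x) (hW : DifferentiableAt ℝ W x)
    (u : E) :
    fderiv ℝ (fun x ↦ G (φ x) (V x) (W x)) x u =
      G (φ x) (covAlong Γ φ V x u) (W x) + G (φ x) (V x) (covAlong Γ φ W x u) := by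
  have hT : DifferentiableAt ℝ (fun x ↦ G (φ x)) x :=
    DifferentiableAt.fun_comp' x hG hφ
  rw [fderiv_clm_apply₂ hT hV hW]
  have : fderiv ℝ (fun x ↦ G (φ x)) x = (fderiv ℝ G (φ x)).comp (fderiv ℝ φ x) :=
    fderiv_fun_comp x hG hφ
  rw [this, ContinuousLinearMap.comp_apply, hc]
  simp only [covAlong, map_add, add_apply]
  ring

/-- The connection is torsion free: `∇_u (dφ λ) - ∇_λ (dφ u) = dφ [u, λ]` for constant `u`. -/
lemma covAlong_torsionFree {Γ : F → F →L[ℝ] F →L[ℝ] F} {φ : E → F} {l : E → E} {x : E}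
    (hs : ∀ a b, Γ (φ x) a b = Γ (φ x) b a) (hφ : ContDiffAt ℝ 2 φ x)
    (hl : DifferentiableAt ℝ l x) (u : E) :
    covAlong Γ φ (fun x ↦ fderiv ℝ φ x u) x (l x) =
      covAlong Γ φ (fun x ↦ fderiv ℝ φ x (l x)) x u - fderiv ℝ φ x (fderiv ℝ l x u) := by
  have hd : DifferentiableAt ℝ (fderiv ℝ φ) x :=
    (hφ.fderiv_right (m := 1) (by norm_num)).differentiableAt (by norm_num)
  have hsymm : fderiv ℝ (fderiv ℝ φ) x (l x) u = fderiv ℝ (fderiv ℝ φ) x u (l x) :=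
    (hφ.isSymmSndFDerivAt (by simp)).eq _ _
  simp only [covAlong]
  rw [fderiv_clm_apply hd hl, fderiv_clm_apply hd (differentiableAt_const u)]
  simp [hsymm, hs (fderiv ℝ φ x u)]
  abel

lemma contDiffAt_covAlong {Γ : F → F →L[ℝ] F →L[ℝ] F} {φ V : E → F} {l : E → E} {x : E}
    (hΓ : ContDiffAt ℝ 1 Γ (φ x)) (hφ : ContDiffAt ℝ 2 φ x) (hV : ContDiffAt ℝ 2 V x)
    (hl : ContDiffAt ℝ 1 l x) : ContDiffAt ℝ 1 (fun x ↦ covAlong Γ φ V x (l x)) x := by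
  have h1 : ContDiffAt ℝ 1 (fderiv ℝ V) x := hV.fderiv_right (by norm_num)
  have h2 : ContDiffAt ℝ 1 (fderiv ℝ φ) x := hφ.fderiv_right (by norm_num)
  have h3 : ContDiffAt ℝ 1 (fun x ↦ Γ (φ x)) x := hΓ.comp x (hφ.of_le (by norm_num))
  exact (h1.clm_apply hl).add
    ((h3.clm_apply (h2.clm_apply hl)).clm_apply (hV.of_le (by norm_num)))

/-- `∇_u ∇_λ V - ∇_λ ∇_u V = R(dφ u, dφ λ) V + ∇_{[u, λ]} V` for constant `u`. -/
lemma covAlong_commutator {Γ : F → F →L[ℝ] F →L[ℝ] F} {φ V : E → F} {l : E → E} {x : E}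
    (hΓ : ContDiffAt ℝ 1 Γ (φ x)) (hφ : ContDiffAt ℝ 2 φ x) (hV : ContDiffAt ℝ 2 V x)
    (hl : DifferentiableAt ℝ l x) (u : E) :
    covAlong Γ φ (fun x ↦ covAlong Γ φ V x u) x (l x) =
      covAlong Γ φ (fun x ↦ covAlong Γ φ V x (l x)) x u
        - curvature Γ (φ x) (fderiv ℝ φ x u) (fderiv ℝ φ x (l x)) (V x)
        - covAlong Γ φ V x (fderiv ℝ l x u) := by
  have hφd : DifferentiableAt ℝ (fderiv ℝ φ) x :=
    (hφ.fderiv_right (m := 1) (by norm_num)).differentiableAt (by norm_num)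
  have hVd : DifferentiableAt ℝ (fderiv ℝ V) x :=
    (hV.fderiv_right (m := 1) (by norm_num)).differentiableAt (by norm_num)
  have hφ1 : DifferentiableAt ℝ φ x := hφ.differentiableAt (by norm_num)
  have hV1 : DifferentiableAt ℝ V x := hV.differentiableAt (by norm_num)
  have hΓ1 : DifferentiableAt ℝ Γ (φ x) := hΓ.differentiableAt (by norm_num)
  have hT : DifferentiableAt ℝ (fun x ↦ Γ (φ x)) x :=
    DifferentiableAt.fun_comp' x hΓ1 hφ1
  have hTd : fderiv ℝ (fun x ↦ Γ (φ x)) x = (fderiv ℝ Γ (φ x)).comp (fderiv ℝ φ x) :=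
    fderiv_fun_comp x hΓ1 hφ1
  have hsφ : fderiv ℝ (fderiv ℝ φ) x (l x) u = fderiv ℝ (fderiv ℝ φ) x u (l x) :=
    (hφ.isSymmSndFDerivAt (by simp)).eq _ _
  have hsV : fderiv ℝ (fderiv ℝ V) x (l x) u = fderiv ℝ (fderiv ℝ V) x u (l x) :=
    (hV.isSymmSndFDerivAt (by simp)).eq _ _
  -- One expansion serves both orders of differentiation, with `m = l` and with `m` constant. In the
  -- difference the second derivatives cancel by symmetry, and the derivative of `l` produces the
  -- bracket term.
  have key : ∀ (m : E → E), DifferentiableAt ℝ m x → ∀ a,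
      fderiv ℝ (fun x ↦ covAlong Γ φ V x (m x)) x a =
        fderiv ℝ (fderiv ℝ V) x a (m x) + fderiv ℝ V x (fderiv ℝ m x a)
        + (fderiv ℝ Γ (φ x) (fderiv ℝ φ x a) (fderiv ℝ φ x (m x)) (V x)
          + Γ (φ x) (fderiv ℝ (fderiv ℝ φ) x a (m x) + fderiv ℝ φ x (fderiv ℝ m x a)) (V x)
          + Γ (φ x) (fderiv ℝ φ x (m x)) (fderiv ℝ V x a)) := by
    intro m hm a
    have h1 : DifferentiableAt ℝ (fun x ↦ fderiv ℝ V x (m x)) x := hVd.clm_apply hm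
    have h2 : DifferentiableAt ℝ (fun x ↦ fderiv ℝ φ x (m x)) x := hφd.clm_apply hm
    have h3 : DifferentiableAt ℝ (fun x ↦ Γ (φ x) (fderiv ℝ φ x (m x)) (V x)) x :=
      (hT.clm_apply h2).clm_apply hV1
    simp only [covAlong]
    rw [fderiv_fun_add h1 h3, add_apply, fderiv_clm_apply₂ hT h2 hV1,
      fderiv_clm_apply hVd hm, fderiv_clm_apply hφd hm, hTd]
    simp only [add_apply, ContinuousLinearMap.comp_apply,
      ContinuousLinearMap.flip_apply]
    abel_nf
  have hcurv : ∀ a b : F, fderiv ℝ (fun y ↦ Γ y a (V x)) (φ x) b = fderiv ℝ Γ (φ x) b a (V x) := by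
    intro a b
    rw [fderiv_clm_apply₂ hΓ1 (differentiableAt_const a) (differentiableAt_const (V x))]
    simp
  have k1 := key l hl u
  have k2 := key (fun _ ↦ u) (differentiableAt_const u) (l x)
  simp only [covAlong] at k1 k2 ⊢
  rw [k2, k1, curvature, hcurv, hcurv]
  simp only [hsφ, hsV, map_add, add_apply, fderiv_fun_const,
    Pi.zero_apply, zero_apply, map_zero, add_zero]
  abel

/-- `G(R(u, v)w, w) = 0`. -/
lemma metric_curvature_self {G : F → F →L[ℝ] F →L[ℝ] ℝ} {Γ : F → F →L[ℝ] F →L[ℝ] F} {y : F}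
    (hG : ContDiffAt ℝ 2 G y) (hΓ : ContDiffAt ℝ 1 Γ y) (hs : ∀ a b, G y a b = G y b a)
    (hc : ∀ᶠ z in 𝓝 y, MetricCompatible G Γ z) (u v w : F) :
    G y (curvature Γ y u v w) w = 0 := by
  have hG1 : DifferentiableAt ℝ G y := hG.differentiableAt (by norm_num)
  have hΓ1 : DifferentiableAt ℝ Γ y := hΓ.differentiableAt (by norm_num)
  have hGd : DifferentiableAt ℝ (fderiv ℝ G) y :=
    (hG.fderiv_right (m := 1) (by norm_num)).differentiableAt (by norm_num)
  -- Metric compatibility, differentiated once more. The last three brackets are zero by symmetry of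
  -- `G y`. The second derivative of `G` is symmetric in `a`, `b`, so antisymmetrizing leaves
  -- 2G(R(u,v)w, w) = 0.
  have key : ∀ a b, fderiv ℝ (fderiv ℝ G) y a b w w =
      2 * (G y (fderiv ℝ (fun z ↦ Γ z b w) y a + Γ y a (Γ y b w)) w
        + G y (Γ y b w) (Γ y a w)) + (G y w (fderiv ℝ (fun z ↦ Γ z b w) y a)
          - G y (fderiv ℝ (fun z ↦ Γ z b w) y a) w)
        + (G y w (Γ y a (Γ y b w)) - G y (Γ y a (Γ y b w)) w)
        + (G y (Γ y a w) (Γ y b w) - G y (Γ y b w) (Γ y a w)) := by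
    intro a b
    have hd : DifferentiableAt ℝ (fun z ↦ Γ z b w) y :=
      (hΓ1.clm_apply (differentiableAt_const b)).clm_apply (differentiableAt_const w)
    have e1 : fderiv ℝ (fun z ↦ fderiv ℝ G z b w w) y a = fderiv ℝ (fderiv ℝ G) y a b w w := by
      rw [fderiv_clm_apply₂ (hGd.clm_apply (differentiableAt_const b)) (differentiableAt_const w)
        (differentiableAt_const w), fderiv_clm_apply hGd (differentiableAt_const b)]
      simp
    have e2 : (fun z ↦ fderiv ℝ G z b w w) =ᶠ[𝓝 y]
        fun z ↦ G z (Γ z b w) w + G z w (Γ z b w) := by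
      filter_upwards [hc] with z hz using hz b w w
    have d1 : DifferentiableAt ℝ (fun z ↦ G z (Γ z b w) w) y :=
      (hG1.clm_apply hd).clm_apply (differentiableAt_const w)
    have d2 : DifferentiableAt ℝ (fun z ↦ G z w (Γ z b w)) y :=
      (hG1.clm_apply (differentiableAt_const w)).clm_apply hd
    rw [← e1, e2.fderiv_eq, fderiv_fun_add d1 d2, add_apply,
      fderiv_clm_apply₂ hG1 hd (differentiableAt_const w),
      fderiv_clm_apply₂ hG1 (differentiableAt_const w) hd, hc.self_of_nhds, hc.self_of_nhds]
    simp
    ring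
  have hsymm := ((hG.isSymmSndFDerivAt (by simp)).eq u v)
  have h1 := key u v
  have h2 := key v u
  rw [hsymm, h2] at h1
  simp only [hs w, hs (Γ y u w), sub_self, add_zero] at h1
  simp only [curvature, map_add, map_sub, add_apply,
    sub_apply] at h1 ⊢
  linarith

end Calculus

/-! ### Linear algebra of a null vector and its orthogonal complement. -/

section LinearAlgebra

variable {F : Type*} [NormedAddCommGroup F] [NormedSpace ℝ F]

/-- A null vector `l` and an orthonormal pair `e` orthogonal to it, for a nondegenerate symmetric
bilinear form `G`. -/
structure IsNullFrame (G : F →L[ℝ] F →L[ℝ] ℝ) (l : F) (e : Fin 2 → F) : Prop where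
  symm (a b : F) : G a b = G b a
  nondegenerate (a : F) : (∀ b, G a b = 0) → a = 0
  ne_zero : l ≠ 0
  null : G l l = 0
  orthogonal (A : Fin 2) : G l (e A) = 0
  orthonormal (A B : Fin 2) : G (e A) (e B) = if A = B then 1 else 0

/-- The orthogonal complement of `l` is spanned by `l` and `e`. -/
lemma IsNullFrame.exists_eq {G : F →L[ℝ] F →L[ℝ] ℝ} {l : F} {e : Fin 2 → F}
    (hf : IsNullFrame G l e) (hF : Module.finrank ℝ F = 4) (w : F) (hw : G w l = 0) :
    ∃ a : ℝ, w = a • l + G w (e 0) • e 0 + G w (e 1) • e 1 := by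
  have h00 := hf.orthonormal 0 0
  have h01 := hf.orthonormal 0 1
  have h10 := hf.orthonormal 1 0
  have h11 := hf.orthonormal 1 1
  have l0 := hf.orthogonal 0
  have l1 := hf.orthogonal 1
  have l0' := (hf.symm (e 0) l).trans l0
  have l1' := (hf.symm (e 1) l).trans l1
  simp at h00 h01 h10 h11
  set w' := w - G w (e 0) • e 0 - G w (e 1) • e 1 with hw'
  suffices ∃ a : ℝ, w' = a • l by
    obtain ⟨a, ha⟩ := this
    exact ⟨a, by rw [← ha, hw']; abel⟩
  have w0 : G w' (e 0) = 0 := by simp [hw', h00, h10]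
  have w1 : G w' (e 1) = 0 := by simp [hw', h01, h11]
  have wl : G w' l = 0 := by simp [hw', hw, l0', l1']
  -- Otherwise `w'`, `l`, `e 0`, `e 1` would be a basis consisting of vectors orthogonal to `l`,
  -- contradicting nondegeneracy.
  by_contra! hne
  have hli : LinearIndependent ℝ ![w', l, e 0, e 1] := by
    rw [Fintype.linearIndependent_iff]
    intro c hc
    simp only [Fin.sum_univ_four, Matrix.cons_val] at hc
    have c2 : c 2 = 0 := by
      have := congrArg (fun v ↦ G v (e 0)) hc
      simpa [w0, l0, h00, h10] using this
    have c3 : c 3 = 0 := by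
      have := congrArg (fun v ↦ G v (e 1)) hc
      simpa [w1, l1, h01, h11] using this
    rw [c2, c3, zero_smul, zero_smul, add_zero, add_zero] at hc
    have c0 : c 0 = 0 := by
      by_contra h0
      refine hne (-(c 0)⁻¹ * c 1) ?_
      have := congrArg (fun v ↦ (c 0)⁻¹ • v) hc
      simp only [smul_add, smul_smul, inv_mul_cancel₀ h0, one_smul, smul_zero] at this
      rw [neg_mul, neg_smul]
      exact eq_neg_of_add_eq_zero_left this
    rw [c0, zero_smul, zero_add] at hc
    have c1 := (smul_eq_zero.mp hc).resolve_right hf.ne_zero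
    intro i
    fin_cases i <;> assumption
  have : FiniteDimensional ℝ F := Module.finite_of_finrank_eq_succ hF
  let b := basisOfLinearIndependentOfCardEqFinrank hli (by simp [hF])
  have hb : ⇑b = ![w', l, e 0, e 1] := coe_basisOfLinearIndependentOfCardEqFinrank hli _
  have hz : (G l : F →ₗ[ℝ] ℝ) = 0 := by
    refine b.ext fun i ↦ ?_
    rw [hb]
    fin_cases i
    · simpa using (hf.symm l w').trans wl
    · simpa using hf.null
    · simpa using l0
    · simpa using l1
  exact hf.ne_zero (hf.nondegenerate l fun v ↦ DFunLike.congr_fun hz v)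

/-- The trace of an endomorphism that kills `l` and maps into the orthogonal complement of `l`. -/
lemma IsNullFrame.trace_eq {G : F →L[ℝ] F →L[ℝ] ℝ} {l : F} {e : Fin 2 → F}
    (hf : IsNullFrame G l e) (hF : Module.finrank ℝ F = 4) (T : F →ₗ[ℝ] F) (hl : T l = 0)
    (hT : ∀ u, G (T u) l = 0) :
    LinearMap.trace ℝ F T = ∑ A, G (T (e A)) (e A) := by
  have h00 := hf.orthonormal 0 0
  have h01 := hf.orthonormal 0 1
  have h10 := hf.orthonormal 1 0
  have h11 := hf.orthonormal 1 1
  have l0 := hf.orthogonal 0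
  have l1 := hf.orthogonal 1
  have l0' := (hf.symm (e 0) l).trans l0
  have l1' := (hf.symm (e 1) l).trans l1
  simp at h00 h01 h10 h11
  -- A vector `n` not orthogonal to `l` completes `l`, `e 0`, `e 1` to a basis. The image of `T`
  -- lies in the span of the first three vectors, so `n` adds nothing to the trace; nor does `l`,
  -- since `T l = 0`.
  obtain ⟨n, hn⟩ : ∃ n, G l n ≠ 0 := by
    by_contra! h
    exact hf.ne_zero (hf.nondegenerate l h)
  have hli : LinearIndependent ℝ ![l, e 0, e 1, n] := by
    rw [Fintype.linearIndependent_iff]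
    intro c hc
    simp only [Fin.sum_univ_four, Matrix.cons_val] at hc
    have c3 : c 3 = 0 := by
      have := congrArg (fun v ↦ G l v) hc
      simpa [l0, l1, hf.null, hn] using this
    rw [c3, zero_smul, add_zero] at hc
    have c1 : c 1 = 0 := by
      have := congrArg (fun v ↦ G v (e 0)) hc
      simpa [l0, h00, h10] using this
    have c2 : c 2 = 0 := by
      have := congrArg (fun v ↦ G v (e 1)) hc
      simpa [l1, h01, h11] using this
    rw [c1, c2, zero_smul, zero_smul, add_zero, add_zero] at hc
    have c0 := (smul_eq_zero.mp hc).resolve_right hf.ne_zero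
    intro i
    fin_cases i <;> assumption
  have : FiniteDimensional ℝ F := Module.finite_of_finrank_eq_succ hF
  let b := basisOfLinearIndependentOfCardEqFinrank hli (by simp [hF])
  have hb : ⇑b = ![l, e 0, e 1, n] := coe_basisOfLinearIndependentOfCardEqFinrank hli _
  have b0 : b 0 = l := by simp [hb]
  have b1 : b 1 = e 0 := by simp [hb]
  have b2 : b 2 = e 1 := by simp [hb]
  have b3 : b 3 = n := by simp [hb]
  have hrepr : ∀ u i, b.repr (T u) i =
      if i = 1 then G (T u) (e 0) else if i = 2 then G (T u) (e 1) else
        if i = 3 then 0 else b.repr (T u) i := by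
    intro u i
    obtain ⟨a, ha⟩ := hf.exists_eq hF (T u) (hT u)
    have : b.repr (T u) = Finsupp.single 0 a + Finsupp.single 1 (G (T u) (e 0))
        + Finsupp.single 2 (G (T u) (e 1)) := by
      nth_rw 1 [ha]
      rw [← b0, ← b1, ← b2]
      simp only [map_add, map_smul, Module.Basis.repr_self, Finsupp.smul_single, smul_eq_mul,
        mul_one]
    rw [this]
    fin_cases i <;> simp
  rw [LinearMap.trace_eq_matrix_trace ℝ b, Matrix.trace]
  simp only [Matrix.diag_apply, LinearMap.toMatrix_apply, Fin.sum_univ_four, Fin.sum_univ_two]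
  rw [hrepr (b 1), hrepr (b 2), hrepr (b 3), b0, hl, b1, b2]
  simp

end LinearAlgebra

/-! ### The Riccati and Raychaudhuri equations on a null hypersurface. -/

section Raychaudhuri

variable {E F : Type*} [NormedAddCommGroup E] [NormedSpace ℝ E] [NormedAddCommGroup F]
  [NormedSpace ℝ F]

/-- A null immersed hypersurface `φ`, near the point `x`, with null tangent field `l`, in
coordinates in which the metric is `G` and the Levi-Civita connection is `Γ`. -/
structure IsNullGerm (G : F → F →L[ℝ] F →L[ℝ] ℝ) (Γ : F → F →L[ℝ] F →L[ℝ] F) (φ : E → F)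
    (l : E → E) (x : E) : Prop where
  contDiffAt_map : ContDiffAt ℝ 3 φ x
  contDiffAt_field : ContDiffAt ℝ 2 l x
  contDiffAt_metric : ContDiffAt ℝ 2 G (φ x)
  contDiffAt_connection : ContDiffAt ℝ 1 Γ (φ x)
  metric_symm : ∀ᶠ y in 𝓝 (φ x), ∀ a b, G y a b = G y b a
  connection_symm : ∀ᶠ y in 𝓝 (φ x), ∀ a b, Γ y a b = Γ y b a
  compatible : ∀ᶠ y in 𝓝 (φ x), MetricCompatible G Γ y
  null : ∀ᶠ z in 𝓝 x, ∀ w, G (φ z) (fderiv ℝ φ z (l z)) (fderiv ℝ φ z w) = 0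

/-- The metric induced by `φ`, in coordinates. -/
def pullbackMetric (G : F → F →L[ℝ] F →L[ℝ] ℝ) (φ : E → F) (x u v : E) : ℝ :=
  G (φ x) (fderiv ℝ φ x u) (fderiv ℝ φ x v)

/-- The form `g(∇_u l, v)`, in coordinates. -/
def coordForm (G : F → F →L[ℝ] F →L[ℝ] ℝ) (Γ : F → F →L[ℝ] F →L[ℝ] F) (φ : E → F)
    (l : E → E) (x u v : E) : ℝ :=
  G (φ x) (covAlong Γ φ (fun z ↦ fderiv ℝ φ z (l z)) x u) (fderiv ℝ φ x v)

namespace IsNullGerm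

variable {G : F → F →L[ℝ] F →L[ℝ] ℝ} {Γ : F → F →L[ℝ] F →L[ℝ] F} {φ : E → F} {l : E → E} {x : E}

/-- Every condition is open. Pointwise consequences of being a null germ thus hold near `x` and may
be differentiated. -/
lemma eventually (h : IsNullGerm G Γ φ l x) : ∀ᶠ z in 𝓝 x, IsNullGerm G Γ φ l z := by
  have hφ : Filter.Tendsto φ (𝓝 x) (𝓝 (φ x)) := h.contDiffAt_map.continuousAt
  filter_upwards [h.contDiffAt_map.eventually (by simp), h.contDiffAt_field.eventually (by simp),
    hφ.eventually (h.contDiffAt_metric.eventually (by simp)),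
    hφ.eventually (h.contDiffAt_connection.eventually (by simp)),
    hφ.eventually h.metric_symm.eventually_nhds, hφ.eventually h.connection_symm.eventually_nhds,
    hφ.eventually h.compatible.eventually_nhds, h.null.eventually_nhds]
    with z h1 h2 h3 h4 h5 h6 h7 h8 using ⟨h1, h2, h3, h4, h5, h6, h7, h8⟩

lemma contDiffAt_fderiv (h : IsNullGerm G Γ φ l x) : ContDiffAt ℝ 2 (fderiv ℝ φ) x :=
  h.contDiffAt_map.fderiv_right (by norm_num)

lemma contDiffAt_push (h : IsNullGerm G Γ φ l x) :
    ContDiffAt ℝ 2 (fun z ↦ fderiv ℝ φ z (l z)) x :=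
  h.contDiffAt_fderiv.clm_apply h.contDiffAt_field

lemma differentiableAt_fderiv (h : IsNullGerm G Γ φ l x) (w : E) :
    DifferentiableAt ℝ (fun z ↦ fderiv ℝ φ z w) x :=
  (h.contDiffAt_fderiv.clm_apply contDiffAt_const).differentiableAt (by norm_num)

/-- The product rule for the metric along `φ`. -/
lemma fderiv_metric (h : IsNullGerm G Γ φ l x) {V W : E → F} (hV : DifferentiableAt ℝ V x)
    (hW : DifferentiableAt ℝ W x) (u : E) :
    fderiv ℝ (fun x ↦ G (φ x) (V x) (W x)) x u =
      G (φ x) (covAlong Γ φ V x u) (W x) + G (φ x) (V x) (covAlong Γ φ W x u) :=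
  NullTube.fderiv_metric (h.contDiffAt_metric.differentiableAt (by norm_num))
    h.compatible.self_of_nhds (h.contDiffAt_map.differentiableAt (by norm_num)) hV hW u

lemma metric_comm (h : IsNullGerm G Γ φ l x) (a b : F) : G (φ x) a b = G (φ x) b a :=
  h.metric_symm.self_of_nhds a b

/-- `∇_l u = ∇_u l - [u, l]` for constant `u`. -/
lemma covAlong_field (h : IsNullGerm G Γ φ l x) (u : E) :
    covAlong Γ φ (fun z ↦ fderiv ℝ φ z u) x (l x) =
      covAlong Γ φ (fun z ↦ fderiv ℝ φ z (l z)) x u - fderiv ℝ φ x (fderiv ℝ l x u) :=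
  covAlong_torsionFree h.connection_symm.self_of_nhds (h.contDiffAt_map.of_le (by norm_num))
    (h.contDiffAt_field.differentiableAt (by norm_num)) u

/-- Half the derivative of g(l, l) = 0. -/
lemma metric_covAlong_self (h : IsNullGerm G Γ φ l x) (u : E) :
    G (φ x) (covAlong Γ φ (fun z ↦ fderiv ℝ φ z (l z)) x u) (fderiv ℝ φ x (l x)) = 0 := by
  have hd := h.contDiffAt_push.differentiableAt (by norm_num)
  have h1 := h.fderiv_metric hd hd u
  have h2 : (fun z ↦ G (φ z) (fderiv ℝ φ z (l z)) (fderiv ℝ φ z (l z))) =ᶠ[𝓝 x] fun _ ↦ 0 := by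
    filter_upwards [h.null] with z hz using hz (l z)
  rw [h2.fderiv_eq, h.metric_comm (fderiv ℝ φ x (l x))] at h1
  simp at h1
  linarith

/-- The derivative of g(l, w) = 0 for constant `w`: the form is, up to sign, the second fundamental
form with normal `l`. -/
lemma coordForm_eq_neg (h : IsNullGerm G Γ φ l x) (u w : E) :
    coordForm G Γ φ l x u w = - G (φ x) (fderiv ℝ φ x (l x))
      (covAlong Γ φ (fun z ↦ fderiv ℝ φ z w) x u) := by
  have h1 := h.fderiv_metric (h.contDiffAt_push.differentiableAt (by norm_num))
    (h.differentiableAt_fderiv w) u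
  have h2 : (fun z ↦ G (φ z) (fderiv ℝ φ z (l z)) (fderiv ℝ φ z w)) =ᶠ[𝓝 x] fun _ ↦ 0 := by
    filter_upwards [h.null] with z hz using hz w
  rw [h2.fderiv_eq] at h1
  simp only [fderiv_fun_const, Pi.zero_apply, zero_apply] at h1
  rw [coordForm]
  linarith

/-- By `coordForm_eq_neg` this reduces to ∇_u (dφ w) = ∇_w (dφ u) for constant `u`, `w`: symmetry of
second derivatives and absence of torsion. -/
lemma coordForm_comm (h : IsNullGerm G Γ φ l x) (u w : E) :
    coordForm G Γ φ l x u w = coordForm G Γ φ l x w u := by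
  have hd : DifferentiableAt ℝ (fderiv ℝ φ) x :=
    h.contDiffAt_fderiv.differentiableAt (by norm_num)
  have hs : fderiv ℝ (fderiv ℝ φ) x u w = fderiv ℝ (fderiv ℝ φ) x w u :=
    (h.contDiffAt_map.isSymmSndFDerivAt (by simp; norm_num)).eq _ _
  rw [h.coordForm_eq_neg, h.coordForm_eq_neg]
  simp only [covAlong]
  rw [fderiv_clm_apply hd (differentiableAt_const w), fderiv_clm_apply hd (differentiableAt_const u)]
  simp [hs, h.connection_symm.self_of_nhds (fderiv ℝ φ x u)]

/-- Symmetry turns g(∇_w l, l) = 0 into g(∇_l l, w) = 0: the integral curves of `l` are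
pregeodesics. -/
lemma coordForm_field_left (h : IsNullGerm G Γ φ l x) (w : E) :
    coordForm G Γ φ l x (l x) w = 0 := by
  rw [h.coordForm_comm]
  exact h.metric_covAlong_self w

/-- The Lie derivative of the induced metric along `l` is twice the form; the two correction terms
come from the brackets of `l` with the constant fields `u`, `v`. -/
lemma fderiv_pullbackMetric (h : IsNullGerm G Γ φ l x) (u v : E) :
    fderiv ℝ (fun z ↦ pullbackMetric G φ z u v) x (l x) =
      2 * coordForm G Γ φ l x u v - pullbackMetric G φ x (fderiv ℝ l x u) v
        - pullbackMetric G φ x u (fderiv ℝ l x v) := by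
  have h1 := h.fderiv_metric (h.differentiableAt_fderiv u) (h.differentiableAt_fderiv v) (l x)
  rw [h.covAlong_field, h.covAlong_field] at h1
  have h2 := h.coordForm_comm u v
  simp only [pullbackMetric, coordForm, map_sub, sub_apply] at h1 h2 ⊢
  rw [h.metric_comm (fderiv ℝ φ x u) (covAlong _ _ _ _ v)] at h1
  linarith

lemma differentiableAt_pullbackMetric (h : IsNullGerm G Γ φ l x) (u v : E) :
    DifferentiableAt ℝ (fun z ↦ pullbackMetric G φ z u v) x := by
  have hT : DifferentiableAt ℝ (fun x ↦ G (φ x)) x :=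
    DifferentiableAt.fun_comp' x (h.contDiffAt_metric.differentiableAt (by norm_num))
      (h.contDiffAt_map.differentiableAt (by norm_num))
  exact (hT.clm_apply (h.differentiableAt_fderiv u)).clm_apply (h.differentiableAt_fderiv v)

lemma differentiableAt_covAlong (h : IsNullGerm G Γ φ l x) {m : E → E} (hm : ContDiffAt ℝ 1 m x) :
    DifferentiableAt ℝ
      (fun z ↦ covAlong Γ φ (fun z ↦ fderiv ℝ φ z (l z)) z (m z)) x :=
  (contDiffAt_covAlong h.contDiffAt_connection (h.contDiffAt_map.of_le (by norm_num))
    h.contDiffAt_push hm).differentiableAt (by norm_num)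

lemma differentiableAt_coordForm (h : IsNullGerm G Γ φ l x) (u v : E) :
    DifferentiableAt ℝ (fun z ↦ coordForm G Γ φ l z u v) x := by
  have hT : DifferentiableAt ℝ (fun x ↦ G (φ x)) x :=
    DifferentiableAt.fun_comp' x (h.contDiffAt_metric.differentiableAt (by norm_num))
      (h.contDiffAt_map.differentiableAt (by norm_num))
  exact (hT.clm_apply (h.differentiableAt_covAlong contDiffAt_const)).clm_apply
    (h.differentiableAt_fderiv v)

/-- If `∇_l l = κ l` at `x`, then `g(∇_u ∇_l l, w) = κ g(∇_u l, w)` at `x`. -/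
lemma metric_covAlong_acceleration (h : IsNullGerm G Γ φ l x) {κ : ℝ}
    (hκ : covAlong Γ φ (fun z ↦ fderiv ℝ φ z (l z)) x (l x) = κ • fderiv ℝ φ x (l x)) (u w : E) :
    G (φ x) (covAlong Γ φ (fun z ↦ covAlong Γ φ (fun z ↦ fderiv ℝ φ z (l z)) z (l z)) x u)
      (fderiv ℝ φ x w) = κ * coordForm G Γ φ l x u w := by
  have h1 := h.fderiv_metric
    (h.differentiableAt_covAlong (h.contDiffAt_field.of_le (by norm_num)))
    (h.differentiableAt_fderiv w) u
  have h2 : (fun z ↦ G (φ z) (covAlong Γ φ (fun z ↦ fderiv ℝ φ z (l z)) z (l z))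
      (fderiv ℝ φ z w)) =ᶠ[𝓝 x] fun _ ↦ 0 := by
    filter_upwards [h.eventually] with z hz using hz.coordForm_field_left w
  rw [h2.fderiv_eq, hκ] at h1
  simp only [fderiv_fun_const, Pi.zero_apply, zero_apply, map_smul, smul_apply, smul_eq_mul] at h1
  rw [h.coordForm_eq_neg]
  linarith

/-- The Riccati equation for the null second fundamental form. -/
lemma fderiv_coordForm (h : IsNullGerm G Γ φ l x) {κ : ℝ}
    (hκ : covAlong Γ φ (fun z ↦ fderiv ℝ φ z (l z)) x (l x) = κ • fderiv ℝ φ x (l x)) (u w : E) :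
    fderiv ℝ (fun z ↦ coordForm G Γ φ l z u w) x (l x) =
      κ * coordForm G Γ φ l x u w
        - G (φ x) (curvature Γ (φ x) (fderiv ℝ φ x u) (fderiv ℝ φ x (l x)) (fderiv ℝ φ x (l x)))
          (fderiv ℝ φ x w)
        - coordForm G Γ φ l x (fderiv ℝ l x u) w
        + G (φ x) (covAlong Γ φ (fun z ↦ fderiv ℝ φ z (l z)) x u)
          (covAlong Γ φ (fun z ↦ fderiv ℝ φ z (l z)) x w)
        - coordForm G Γ φ l x u (fderiv ℝ l x w) := by
  -- Differentiate g(∇_u l, dφ w) along `l`. Commuting ∇_l with ∇_u produces the curvature and ∇_u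
  -- ∇_l l, which gives the κ term; ∇_l (dφ w) produces the quadratic term.
  have h1 := h.fderiv_metric (h.differentiableAt_covAlong (m := fun _ ↦ u) contDiffAt_const)
    (h.differentiableAt_fderiv w) (l x)
  rw [covAlong_commutator h.contDiffAt_connection (h.contDiffAt_map.of_le (by norm_num))
    h.contDiffAt_push (h.contDiffAt_field.differentiableAt (by norm_num)), h.covAlong_field] at h1
  have h2 := h.metric_covAlong_acceleration hκ u w
  simp only [coordForm, map_sub, sub_apply] at h1 h2 ⊢
  rw [h1, h2]
  ring

/-- The form ignores the `l` component of `w`, so only the components along `e` survive. This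
resolves the bracket terms of the Riccati equation. -/
lemma coordForm_eq_sum (h : IsNullGerm G Γ φ l x) (hF : Module.finrank ℝ F = 4) {e : Fin 2 → E}
    (hf : IsNullFrame (G (φ x)) (fderiv ℝ φ x (l x)) (fun A ↦ fderiv ℝ φ x (e A))) (u w : E) :
    coordForm G Γ φ l x u w = pullbackMetric G φ x w (e 0) * coordForm G Γ φ l x u (e 0)
      + pullbackMetric G φ x w (e 1) * coordForm G Γ φ l x u (e 1) := by
  obtain ⟨a, ha⟩ := hf.exists_eq hF (fderiv ℝ φ x w)
    ((h.metric_comm _ _).trans (h.null.self_of_nhds w))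
  have := h.metric_covAlong_self u
  simp only [coordForm, pullbackMetric] at ha this ⊢
  nth_rw 1 [ha]
  simp only [map_add, map_smul, smul_eq_mul, this]
  ring

/-- The Raychaudhuri equation for a null hypersurface with vanishing expansion. -/
theorem sum_curvature (h : IsNullGerm G Γ φ l x) (hF : Module.finrank ℝ F = 4) {e : Fin 2 → E}
    (hf : IsNullFrame (G (φ x)) (fderiv ℝ φ x (l x)) (fun A ↦ fderiv ℝ φ x (e A)))
    (htr : ∀ᶠ z in 𝓝 x, ∀ u v,
      pullbackMetric G φ z v v * coordForm G Γ φ l z u u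
        - 2 * (pullbackMetric G φ z u v * coordForm G Γ φ l z u v)
        + pullbackMetric G φ z u u * coordForm G Γ φ l z v v = 0) :
    ∑ A, G (φ x) (curvature Γ (φ x) (fderiv ℝ φ x (e A)) (fderiv ℝ φ x (l x))
      (fderiv ℝ φ x (l x))) (fderiv ℝ φ x (e A)) =
      - ∑ A, ∑ B, coordForm G Γ φ l x (e A) (e B) ^ 2 := by
  have p00 : pullbackMetric G φ x (e 0) (e 0) = 1 := by
    simpa [pullbackMetric] using hf.orthonormal 0 0
  have p01 : pullbackMetric G φ x (e 0) (e 1) = 0 := by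
    simpa [pullbackMetric] using hf.orthonormal 0 1
  have p11 : pullbackMetric G φ x (e 1) (e 1) = 1 := by
    simpa [pullbackMetric] using hf.orthonormal 1 1
  have hsymm : ∀ u w, pullbackMetric G φ x u w = pullbackMetric G φ x w u :=
    fun u w ↦ h.metric_comm _ _
  obtain ⟨κ, hκ⟩ : ∃ κ : ℝ, covAlong Γ φ (fun z ↦ fderiv ℝ φ z (l z)) x (l x) =
      κ • fderiv ℝ φ x (l x) := by
    obtain ⟨κ, hκ⟩ := hf.exists_eq hF (covAlong Γ φ (fun z ↦ fderiv ℝ φ z (l z)) x (l x))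
      (h.metric_covAlong_self _)
    have h0 : ∀ A, G (φ x) (covAlong Γ φ (fun z ↦ fderiv ℝ φ z (l z)) x (l x))
      (fderiv ℝ φ x (e A)) = 0 := fun A ↦ h.coordForm_field_left (e A)
    exact ⟨κ, by simpa [h0] using hκ⟩
  -- ∇_{e_A} l is orthogonal to `l`, so its component along `l` does not contribute to its square.
  have hq : ∀ A, G (φ x) (covAlong Γ φ (fun z ↦ fderiv ℝ φ z (l z)) x (e A))
      (covAlong Γ φ (fun z ↦ fderiv ℝ φ z (l z)) x (e A)) =
      coordForm G Γ φ l x (e A) (e 0) ^ 2 + coordForm G Γ φ l x (e A) (e 1) ^ 2 := by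
    intro A
    obtain ⟨a, ha⟩ := hf.exists_eq hF (covAlong Γ φ (fun z ↦ fderiv ℝ φ z (l z)) x (e A))
      (h.metric_covAlong_self _)
    have h0 := h.metric_covAlong_self (e A)
    nth_rw 2 [ha]
    simp only [map_add, map_smul, smul_eq_mul, h0, coordForm]
    ring
  have tr0 := htr.self_of_nhds (e 0) (e 1)
  rw [p00, p01, p11] at tr0
  -- The vectors `e 0`, `e 1` are held constant, so they need be orthonormal only at `x`; the metric
  -- coefficients in `htr` account for the change nearby.
  have hder : fderiv ℝ (fun z ↦ pullbackMetric G φ z (e 1) (e 1) * coordForm G Γ φ l z (e 0) (e 0)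
        - 2 * (pullbackMetric G φ z (e 0) (e 1) * coordForm G Γ φ l z (e 0) (e 1))
        + pullbackMetric G φ z (e 0) (e 0) * coordForm G Γ φ l z (e 1) (e 1)) x (l x) = 0 := by
    have : (fun z ↦ pullbackMetric G φ z (e 1) (e 1) * coordForm G Γ φ l z (e 0) (e 0)
        - 2 * (pullbackMetric G φ z (e 0) (e 1) * coordForm G Γ φ l z (e 0) (e 1))
        + pullbackMetric G φ z (e 0) (e 0) * coordForm G Γ φ l z (e 1) (e 1)) =ᶠ[𝓝 x]
        fun _ ↦ 0 := by
      filter_upwards [htr] with z hz using hz (e 0) (e 1)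
    rw [this.fderiv_eq]
    simp
  have hP := fun A B ↦ (h.differentiableAt_pullbackMetric (e A) (e B)).hasFDerivAt
  have hS := fun A B ↦ (h.differentiableAt_coordForm (e A) (e B)).hasFDerivAt
  rw [((((hP 1 1).fun_mul (hS 0 0)).fun_sub (((hP 0 1).fun_mul (hS 0 1)).const_mul 2)).fun_add
    ((hP 0 0).fun_mul (hS 1 1))).fderiv] at hder
  simp only [add_apply, sub_apply, smul_apply, smul_eq_mul, h.fderiv_pullbackMetric,
    h.fderiv_coordForm hκ, p00, p01, p11, hq] at hder
  have c1 : ∀ A, coordForm G Γ φ l x (fderiv ℝ l x (e A)) (e A) =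
      coordForm G Γ φ l x (e A) (fderiv ℝ l x (e A)) := fun A ↦ h.coordForm_comm _ _
  have c2 := fun A ↦ h.coordForm_eq_sum hF hf (e A) (fderiv ℝ l x (e A))
  have c3 := h.coordForm_comm (e 1) (e 0)
  rw [hsymm (e 0) (fderiv ℝ l x (e 0)), hsymm (e 0) (fderiv ℝ l x (e 1)),
    hsymm (e 1) (fderiv ℝ l x (e 1)), c1, c1, c2, c2, c3] at hder
  rw [Fin.sum_univ_two, Fin.sum_univ_two, Fin.sum_univ_two, Fin.sum_univ_two, c3]
  have hb : coordForm G Γ φ l x (e 1) (e 1) = - coordForm G Γ φ l x (e 0) (e 0) := by linarith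
  rw [hb] at hder ⊢
  -- With χ₁₁ = -χ₀₀ the κ and bracket terms cancel. Derivatives of the metric coefficients
  -- contribute 4(χ₀₀χ₁₁ - χ₀₁²) = -2|χ|², and the quadratic Riccati terms contribute |χ|².
  linear_combination -hder

end IsNullGerm

end Raychaudhuri

/-! ### The Levi-Civita connection in coordinates, and Ricci curvature as a trace. -/

section LeviCivita

variable {F : Type*} [NormedAddCommGroup F] [NormedSpace ℝ F]

/-- The Christoffel symbols of the first kind of a metric with first derivative `D`. -/
def christoffelFirst (D : F →L[ℝ] F →L[ℝ] F →L[ℝ] ℝ) : F →L[ℝ] F →L[ℝ] F →L[ℝ] ℝ :=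
  (1 / 2 : ℝ) • (D + D.flip -
    ((ContinuousLinearMap.flipₗᵢ ℝ F F ℝ).toContinuousLinearEquiv :
      (F →L[ℝ] F →L[ℝ] ℝ) →L[ℝ] F →L[ℝ] F →L[ℝ] ℝ).comp D.flip)

lemma christoffelFirst_apply (D : F →L[ℝ] F →L[ℝ] F →L[ℝ] ℝ) (u v : F) :
    christoffelFirst D u v = (1 / 2 : ℝ) • (D u v + D v u - (D.flip u).flip v) := rfl

/-- The Levi-Civita connection of the metric `G` in coordinates. -/
def leviCivita (G : F → F →L[ℝ] F →L[ℝ] ℝ) (y : F) : F →L[ℝ] F →L[ℝ] F :=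
  (ContinuousLinearMap.compL ℝ F (F →L[ℝ] ℝ) F (G y).inverse).comp
    (christoffelFirst (fderiv ℝ G y))

lemma leviCivita_apply (G : F → F →L[ℝ] F →L[ℝ] ℝ) (y u v : F) :
    leviCivita G y u v = (G y).inverse (christoffelFirst (fderiv ℝ G y) u v) := rfl

variable {G : F → F →L[ℝ] F →L[ℝ] ℝ} {y : F}

/-- Koszul's formula for constant fields. -/
lemma metric_leviCivita (hi : (G y).IsInvertible) (u v w : F) :
    G y (leviCivita G y u v) w =
      1 / 2 * (fderiv ℝ G y u v w + fderiv ℝ G y v u w - fderiv ℝ G y w u v) := by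
  rw [leviCivita_apply, hi.self_apply_inverse, christoffelFirst_apply]
  rfl

lemma fderiv_metric_comm (hd : DifferentiableAt ℝ G y)
    (hs : ∀ᶠ z in 𝓝 y, ∀ a b, G z a b = G z b a) (a b c : F) :
    fderiv ℝ G y a b c = fderiv ℝ G y a c b := by
  have key : ∀ b c, fderiv ℝ (fun z ↦ G z b c) y a = fderiv ℝ G y a b c := by
    intro b c
    rw [fderiv_clm_apply₂ hd (differentiableAt_const b) (differentiableAt_const c)]
    simp
  have h : (fun z ↦ G z b c) =ᶠ[𝓝 y] fun z ↦ G z c b := by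
    filter_upwards [hs] with z hz using hz b c
  rw [← key, h.fderiv_eq, key]

lemma leviCivita_comm (hd : DifferentiableAt ℝ G y)
    (hs : ∀ᶠ z in 𝓝 y, ∀ a b, G z a b = G z b a) (a b : F) :
    leviCivita G y a b = leviCivita G y b a := by
  rw [leviCivita_apply, leviCivita_apply]
  congr 1
  ext w
  have := fderiv_metric_comm hd hs w a b
  simp only [christoffelFirst_apply, smul_apply, add_apply, sub_apply,
    ContinuousLinearMap.flip_apply, this]
  ring

lemma metricCompatible_leviCivita (hd : DifferentiableAt ℝ G y) (hi : (G y).IsInvertible)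
    (hs : ∀ᶠ z in 𝓝 y, ∀ a b, G z a b = G z b a) : MetricCompatible G (leviCivita G) y := by
  intro a b c
  rw [hs.self_of_nhds b, metric_leviCivita hi, metric_leviCivita hi, fderiv_metric_comm hd hs a c b]
  ring

lemma contDiffAt_leviCivita [CompleteSpace F] {m n : WithTop ℕ∞} (hG : ContDiffAt ℝ n G y)
    (hi : (G y).IsInvertible) (hmn : m + 1 ≤ n) : ContDiffAt ℝ m (leviCivita G) y := by
  have h1 : ContDiffAt ℝ m (fun z ↦ (G z).inverse) y :=
    hi.contDiffAt_map_inverse.comp y (hG.of_le (le_trans le_self_add hmn))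
  have h2 : ContDiffAt ℝ m (fderiv ℝ G) y := hG.fderiv_right hmn
  have h3 : ContDiffAt ℝ m (fun z ↦ (fderiv ℝ G z).flip) y :=
    (ContinuousLinearMap.flipₗᵢ ℝ F F (F →L[ℝ] ℝ)).contDiff.contDiffAt.comp y h2
  have h4 : ContDiffAt ℝ m (fun z ↦ christoffelFirst (fderiv ℝ G z)) y :=
    ((h2.add h3).sub (contDiffAt_const.clm_comp h3)).const_smul (1 / 2 : ℝ)
  exact ((ContinuousLinearMap.compL ℝ F (F →L[ℝ] ℝ) F).contDiff.contDiffAt.comp y h1).clm_comp h4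

lemma curvature_eq {Γ : F → F →L[ℝ] F →L[ℝ] F} (hΓ : DifferentiableAt ℝ Γ y) (u v w : F) :
    curvature Γ y u v w = fderiv ℝ Γ y u v w - fderiv ℝ Γ y v u w
      + Γ y u (Γ y v w) - Γ y v (Γ y u w) := by
  have key : ∀ a b, fderiv ℝ (fun z ↦ Γ z b w) y a = fderiv ℝ Γ y a b w := by
    intro a b
    rw [fderiv_clm_apply₂ hΓ (differentiableAt_const b) (differentiableAt_const w)]
    simp
  rw [curvature, key, key]

/-- The Ricci curvature of a null vector `l` in terms of an orthonormal pair orthogonal to it. -/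
lemma trace_curvature {Γ : F → F →L[ℝ] F →L[ℝ] F} {l : F} {e : Fin 2 → F} {ι : Type*} [Fintype ι]
    [DecidableEq ι] (b : Module.Basis ι ℝ F)
    (hf : IsNullFrame (G y) l e) (hF : Module.finrank ℝ F = 4)
    (hG : ContDiffAt ℝ 2 G y) (hΓ : ContDiffAt ℝ 1 Γ y)
    (hc : ∀ᶠ z in 𝓝 y, MetricCompatible G Γ z) :
    ∑ i, b.repr (curvature Γ y (b i) l l) i = ∑ A, G y (curvature Γ y (e A) l l) (e A) := by
  have hd : DifferentiableAt ℝ Γ y := hΓ.differentiableAt (by norm_num)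
  let T : F →ₗ[ℝ] F :=
    { toFun := fun u ↦ curvature Γ y u l l
      map_add' := fun u v ↦ by
        simp only [curvature_eq hd, map_add, add_apply]
        abel
      map_smul' := fun c u ↦ by
        simp only [curvature_eq hd, map_smul, smul_apply, RingHom.id_apply, smul_sub, smul_add] }
  -- R(l, l)l = 0 by antisymmetry, and g(R(u, l)l, l) = 0 by metric compatibility: the two
  -- hypotheses of the trace formula.
  have h1 := hf.trace_eq hF T (by simp [T, curvature_eq hd])
    (fun u ↦ metric_curvature_self hG hΓ hf.symm hc u l l)
  rw [LinearMap.trace_eq_matrix_trace ℝ b, Matrix.trace] at h1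
  simp only [Matrix.diag_apply, LinearMap.toMatrix_apply] at h1
  exact h1

/-- A nondegenerate bilinear form on a finite-dimensional space is invertible. -/
lemma isInvertible_of_nondegenerate [FiniteDimensional ℝ F] {B : F →L[ℝ] F →L[ℝ] ℝ}
    (hB : ∀ a, (∀ b, B a b = 0) → a = 0) : B.IsInvertible := by
  have hinj : Function.Injective (B : F →ₗ[ℝ] F →L[ℝ] ℝ) := by
    rw [← LinearMap.ker_eq_bot, LinearMap.ker_eq_bot']
    intro a ha
    exact hB a fun b ↦ DFunLike.congr_fun (show B a = 0 from ha) b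
  have hdim : Module.finrank ℝ F = Module.finrank ℝ (F →L[ℝ] ℝ) := by
    rw [← (LinearMap.toContinuousLinearMap (𝕜 := ℝ) (E := F) (F' := ℝ)).finrank_eq]
    exact (Subspace.dual_finrank_eq (K := ℝ) (V := F)).symm
  exact ⟨(LinearEquiv.ofInjectiveOfFinrankEq
    (B : F →ₗ[ℝ] F →L[ℝ] ℝ) hinj hdim).toContinuousLinearEquiv, by ext; rfl⟩

/-- By `fderiv_pullbackMetric` the form is expressed through `l` and the induced metric alone, so
different coordinates on the ambient space give the same form. -/
lemma IsNullGerm.coordForm_congr {E F' : Type*} [NormedAddCommGroup E] [NormedSpace ℝ E]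
    [NormedAddCommGroup F'] [NormedSpace ℝ F'] {Γ : F → F →L[ℝ] F →L[ℝ] F} {φ : E → F}
    {G' : F' → F' →L[ℝ] F' →L[ℝ] ℝ} {Γ' : F' → F' →L[ℝ] F' →L[ℝ] F'} {φ' : E → F'}
    {l : E → E} {x : E} (h : IsNullGerm G Γ φ l x) (h' : IsNullGerm G' Γ' φ' l x)
    (heq : ∀ᶠ z in 𝓝 x, ∀ u v, pullbackMetric G φ z u v = pullbackMetric G' φ' z u v) (u v : E) :
    coordForm G Γ φ l x u v = coordForm G' Γ' φ' l x u v := by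
  have h1 := h.fderiv_pullbackMetric u v
  have h2 := h'.fderiv_pullbackMetric u v
  have h3 : (fun z ↦ pullbackMetric G φ z u v) =ᶠ[𝓝 x] fun z ↦ pullbackMetric G' φ' z u v := by
    filter_upwards [heq] with z hz using hz u v
  rw [h3.fderiv_eq, h2, heq.self_of_nhds, heq.self_of_nhds] at h1
  linarith

end LeviCivita

/-! ### Degenerate symmetric forms on a three-dimensional space. -/

section DegenerateForm

variable {E : Type*} [AddCommGroup E] [Module ℝ E] {h : LinearMap.BilinForm ℝ E}

/-- A nonzero vector `k` in the kernel of a symmetric bilinear form `h`, and an `h`-orthonormal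
pair `e`. -/
structure IsDegenerateFrame (h : LinearMap.BilinForm ℝ E) (k : E) (e : Fin 2 → E) : Prop where
  symm (a b : E) : h a b = h b a
  ne_zero : k ≠ 0
  kernel (a : E) : h k a = 0
  orthonormal (A B : Fin 2) : h (e A) (e B) = if A = B then 1 else 0

lemma IsDegenerateFrame.exists_eq {k : E} {e : Fin 2 → E} (hf : IsDegenerateFrame h k e)
    (hE : Module.finrank ℝ E = 3) (w : E) :
    ∃ a : ℝ, w = a • k + h w (e 0) • e 0 + h w (e 1) • e 1 := by
  have h00 := hf.orthonormal 0 0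
  have h01 := hf.orthonormal 0 1
  have h10 := hf.orthonormal 1 0
  have h11 := hf.orthonormal 1 1
  have k0 := hf.kernel (e 0)
  have k1 := hf.kernel (e 1)
  simp only [if_true, if_neg (show (0 : Fin 2) ≠ 1 by decide),
    if_neg (show (1 : Fin 2) ≠ 0 by decide)] at h00 h01 h10 h11
  have hli : LinearIndependent ℝ ![k, e 0, e 1] := by
    rw [Fintype.linearIndependent_iff]
    intro c hc
    simp only [Fin.sum_univ_three, Matrix.cons_val] at hc
    have c1 : c 1 = 0 := by
      have := congrArg (fun v ↦ h v (e 0)) hc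
      simpa [k0, h00, h10] using this
    have c2 : c 2 = 0 := by
      have := congrArg (fun v ↦ h v (e 1)) hc
      simpa [k1, h01, h11] using this
    rw [c1, c2, zero_smul, zero_smul, add_zero, add_zero] at hc
    have c0 := (smul_eq_zero.mp hc).resolve_right hf.ne_zero
    intro i
    fin_cases i <;> assumption
  have : FiniteDimensional ℝ E := Module.finite_of_finrank_eq_succ hE
  let b := basisOfLinearIndependentOfCardEqFinrank hli (by simp [hE])
  have hb : ⇑b = ![k, e 0, e 1] := coe_basisOfLinearIndependentOfCardEqFinrank hli _
  have hw := b.sum_repr w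
  rw [Fin.sum_univ_three, hb] at hw
  simp only [Matrix.cons_val] at hw
  have e1 : h w (e 0) = b.repr w 1 := by
    have := congrArg (fun v ↦ h v (e 0)) hw
    simpa [k0, h00, h10] using this.symm
  have e2 : h w (e 1) = b.repr w 2 := by
    have := congrArg (fun v ↦ h v (e 1)) hw
    simpa [k1, h01, h11] using this.symm
  exact ⟨b.repr w 0, by rw [e1, e2, hw]⟩

/-- A vector that is null for a positive semidefinite form lies in its kernel. -/
lemma IsDegenerateFrame.null_apply {k : E} {e : Fin 2 → E} (hf : IsDegenerateFrame h k e)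
    (hE : Module.finrank ℝ E = 3) {l : E} (hl : h l l = 0) (w : E) : h l w = 0 := by
  obtain ⟨a, ha⟩ := hf.exists_eq hE l
  -- The form is a sum of two squares modulo its kernel, so a null vector has no component along
  -- `e`.
  have h1 : h l l = h l (e 0) ^ 2 + h l (e 1) ^ 2 := by
    nth_rw 1 [ha]
    simp only [map_add, map_smul, LinearMap.add_apply, LinearMap.smul_apply, smul_eq_mul,
      hf.kernel, hf.symm (e 0) l, hf.symm (e 1) l]
    ring
  have h2 : h l (e 0) = 0 := by nlinarith [sq_nonneg (h l (e 0)), sq_nonneg (h l (e 1))]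
  have h3 : h l (e 1) = 0 := by nlinarith [sq_nonneg (h l (e 0)), sq_nonneg (h l (e 1))]
  rw [h2, h3, zero_smul, zero_smul, add_zero, add_zero] at ha
  rw [ha, map_smul, LinearMap.smul_apply, hf.kernel, smul_zero]

/-- The vanishing of the trace of a symmetric form `B` modulo the kernel `k`, as an identity between
arbitrary pairs of vectors. -/
lemma IsDegenerateFrame.polarized_trace {k : E} {e : Fin 2 → E} (hf : IsDegenerateFrame h k e)
    (hE : Module.finrank ℝ E = 3) {B : LinearMap.BilinForm ℝ E} (hB : ∀ u v, B u v = B v u)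
    (hk : ∀ u, B k u = 0) (htr : ∑ A, B (e A) (e A) = 0) (u v : E) :
    h v v * B u u - 2 * (h u v * B u v) + h u u * B v v = 0 := by
  have h00 := hf.orthonormal 0 0
  have h01 := hf.orthonormal 0 1
  have h10 := hf.orthonormal 1 0
  have h11 := hf.orthonormal 1 1
  simp only [if_true, if_neg (show (0 : Fin 2) ≠ 1 by decide),
    if_neg (show (1 : Fin 2) ≠ 0 by decide)] at h00 h01 h10 h11
  have hk' : ∀ u, B u k = 0 := fun u ↦ (hB u k).trans (hk u)
  have hker : ∀ u, h u k = 0 := fun u ↦ (hf.symm u k).trans (hf.kernel u)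
  have htr' : B (e 1) (e 1) = - B (e 0) (e 0) := by
    rw [Fin.sum_univ_two] at htr
    linarith
  obtain ⟨a, ha⟩ := hf.exists_eq hE u
  obtain ⟨b, hb⟩ := hf.exists_eq hE v
  generalize h u (e 0) = u0 at ha
  generalize h u (e 1) = u1 at ha
  generalize h v (e 0) = v0 at hb
  generalize h v (e 1) = v1 at hb
  subst ha hb
  simp only [map_add, map_smul, LinearMap.add_apply, LinearMap.smul_apply, smul_eq_mul, hf.kernel,
    hker, hk, hk', h00, h01, h10, h11, hB (e 1) (e 0), htr']
  ring

/-- Gram–Schmidt in the plane `W`; definiteness is needed only there. -/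
lemma exists_orthonormal_pair (hs : ∀ a b, h a b = h b a) {W : Submodule ℝ E}
    (hW : Module.finrank ℝ W = 2) (hpos : ∀ a ∈ W, a ≠ 0 → 0 < h a a) :
    ∃ e : Fin 2 → E, (∀ A, e A ∈ W) ∧ ∀ A B, h (e A) (e B) = if A = B then 1 else 0 := by
  have normalize : ∀ a ∈ W, a ≠ 0 → ∃ c : ℝ, c ≠ 0 ∧ h (c • a) (c • a) = 1 := by
    intro a ha h0
    have hp := hpos a ha h0
    have hs := Real.sqrt_pos.mpr hp
    refine ⟨(√(h a a))⁻¹, inv_ne_zero hs.ne', ?_⟩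
    simp only [map_smul, LinearMap.smul_apply, smul_eq_mul]
    rw [← mul_assoc, ← mul_inv, Real.mul_self_sqrt hp.le, inv_mul_cancel₀ hp.ne']
  have : FiniteDimensional ℝ W := Module.finite_of_finrank_eq_succ hW
  let b := Module.finBasisOfFinrankEq ℝ W hW
  have hli : LinearIndependent ℝ ![(b 0 : E), (b 1 : E)] := by
    have hb : ![(b 0 : E), (b 1 : E)] = W.subtype ∘ b := by
      ext i
      fin_cases i <;> rfl
    rw [hb]
    exact b.linearIndependent.map' W.subtype W.ker_subtype
  rw [LinearIndependent.pair_iff] at hli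
  have hb0 : (b 0 : E) ≠ 0 := fun h0 ↦ one_ne_zero (hli 1 0 (by simp [h0])).1
  obtain ⟨c, hc, hc1⟩ := normalize _ (b 0).2 hb0
  set f := c • (b 0 : E) with hf
  have hfW : f ∈ W := W.smul_mem _ (b 0).2
  set w := (b 1 : E) - h (b 1) f • f with hw
  have hwW : w ∈ W := W.sub_mem (b 1).2 (W.smul_mem _ hfW)
  have hw0 : w ≠ 0 := by
    intro h0
    refine one_ne_zero (hli (-(h (b 1) f * c)) 1 ?_).2
    rw [← h0, hw, hf, smul_smul, neg_smul, one_smul]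
    abel
  have hwf : h w f = 0 := by simp [hw, hc1]
  obtain ⟨d, hd, hd1⟩ := normalize w hwW hw0
  refine ⟨![f, d • w], ?_, ?_⟩
  · intro A
    fin_cases A
    · exact hfW
    · exact W.smul_mem _ hwW
  · intro A B
    fin_cases A <;> fin_cases B
    · exact hc1
    · simpa [hs f w] using Or.inr hwf
    · simpa using Or.inr hwf
    · exact hd1

end DegenerateForm

/-! ### Tangent vectors and vector fields in charts. -/

section Charts

variable {k : ℕ} {N : Type*} [TopologicalSpace N] [ChartedSpace (EuclideanSpace ℝ (Fin k)) N]
  [IsManifold (𝓡 k) ∞ N]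

lemma mfderiv_extChartAt_symm_apply {c q : N} (hq : q ∈ (extChartAt (𝓡 k) c).source)
    (v : TangentSpace (𝓡 k) q) :
    mfderiv 𝓘(ℝ, EuclideanSpace ℝ (Fin k)) (𝓡 k) (extChartAt (𝓡 k) c).symm (extChartAt (𝓡 k) c q)
      (mfderiv (𝓡 k) 𝓘(ℝ, EuclideanSpace ℝ (Fin k)) (extChartAt (𝓡 k) c) q v) = v := by
  have : IsManifold (𝓡 k) 1 N := IsManifold.of_le (n := ∞) (by simp)
  have h := mfderivWithin_extChartAt_symm_comp_mfderiv_extChartAt' (I := 𝓡 k) hq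
  rw [ModelWithCorners.range_eq_univ, mfderivWithin_univ] at h
  exact DFunLike.congr_fun h v

lemma mfderiv_extChartAt_apply_symm {c q : N} (hq : q ∈ (extChartAt (𝓡 k) c).source)
    (v : EuclideanSpace ℝ (Fin k)) :
    mfderiv (𝓡 k) 𝓘(ℝ, EuclideanSpace ℝ (Fin k)) (extChartAt (𝓡 k) c) q
      (mfderiv 𝓘(ℝ, EuclideanSpace ℝ (Fin k)) (𝓡 k) (extChartAt (𝓡 k) c).symm
        (extChartAt (𝓡 k) c q) v) = v := by
  have : IsManifold (𝓡 k) 1 N := IsManifold.of_le (n := ∞) (by simp)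
  have h := mfderiv_extChartAt_comp_mfderivWithin_extChartAt_symm' (I := 𝓡 k) hq
  rw [ModelWithCorners.range_eq_univ, mfderivWithin_univ] at h
  exact DFunLike.congr_fun h v

/-- Smooth vector fields have smooth coordinates. -/
lemma contDiffAt_coord_field {L : ∀ p : N, TangentSpace (𝓡 k) p}
    (hL : ContMDiff (𝓡 k) (𝓡 k).tangent ∞ (fun p ↦ (⟨p, L p⟩ : TangentBundle (𝓡 k) N)))
    {c q : N} (hq : q ∈ (extChartAt (𝓡 k) c).source) :
    ContDiffAt ℝ ∞ (fun z ↦ mfderiv (𝓡 k) 𝓘(ℝ, EuclideanSpace ℝ (Fin k)) (extChartAt (𝓡 k) c)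
      ((extChartAt (𝓡 k) c).symm z) (L ((extChartAt (𝓡 k) c).symm z)) :
        EuclideanSpace ℝ (Fin k) → EuclideanSpace ℝ (Fin k)) (extChartAt (𝓡 k) c q) := by
  have : IsManifold (𝓡 k) 1 N := IsManifold.of_le (n := ∞) (by simp)
  have hq' : q ∈ (chartAt (EuclideanSpace ℝ (Fin k)) c).source := by
    rwa [extChartAt_source] at hq
  set e := trivializationAt (EuclideanSpace ℝ (Fin k)) (TangentSpace (𝓡 k)) c
  have h1 : ContMDiffAt (𝓡 k) 𝓘(ℝ, EuclideanSpace ℝ (Fin k)) ∞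
      (fun p ↦ (e (⟨p, L p⟩ : TangentBundle (𝓡 k) N)).2) q :=
    (e.contMDiffAt_section_iff (by simpa [e] using hq')).mp hL.contMDiffAt
  have h2 : ContMDiffAt 𝓘(ℝ, EuclideanSpace ℝ (Fin k)) (𝓡 k) ∞ (extChartAt (𝓡 k) c).symm
      (extChartAt (𝓡 k) c q) :=
    (contMDiffOn_extChartAt_symm c).contMDiffAt
      ((isOpen_extChartAt_target c).mem_nhds ((extChartAt (𝓡 k) c).map_source hq))
  rw [← (extChartAt (𝓡 k) c).left_inv hq] at h1
  have h3 := (h1.comp _ h2).contDiffAt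
  refine h3.congr_of_eventuallyEq ?_
  filter_upwards [(isOpen_extChartAt_target c).mem_nhds
    ((extChartAt (𝓡 k) c).map_source hq)] with z hz
  have hz' : (extChartAt (𝓡 k) c).symm z ∈ (chartAt (EuclideanSpace ℝ (Fin k)) c).source := by
    simpa using (extChartAt (𝓡 k) c).map_target hz
  rw [← TangentBundle.continuousLinearMapAt_trivializationAt hz']
  exact congrFun (e.coe_linearMapAt_of_mem (R := ℝ) (by simpa [e] using hz')) _

end Charts

/-! ### The Lorentzian metric in a chart. -/

section Coordinates

variable {M : Type*} [TopologicalSpace M] [ChartedSpace (EuclideanSpace ℝ (Fin 4)) M]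
  [IsManifold (𝓡 4) ∞ M] (g : LorentzianMetric M)

lemma LorentzianMetric.eq_zero_of_forall {x : M} {v : TangentSpace (𝓡 4) x}
    (h : ∀ w, g.inner x v w = 0) : v = 0 := by
  obtain ⟨b, hb⟩ := g.exists_frame x
  refine b.repr.injective (Finsupp.ext fun j ↦ ?_)
  have h1 := h (b j)
  rw [← b.sum_repr v] at h1
  simp only [map_sum, map_smul, sum_apply, smul_apply, hb, smul_eq_mul] at h1
  have h2 : b.repr v j * (if j = 0 then -1 else 1) = 0 := by simpa using h1
  rw [map_zero, Finsupp.zero_apply]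
  refine (mul_eq_zero.mp h2).resolve_right ?_
  split_ifs <;> norm_num

lemma ofCoord_toCoord {c m : M} (hm : m ∈ (extChartAt (𝓡 4) c).source)
    (v : TangentSpace (𝓡 4) m) : ofCoord c (extChartAt (𝓡 4) c m) (toCoord c m v) = v :=
  mfderiv_extChartAt_symm_apply hm v

lemma toCoord_ofCoord {c m : M} (hm : m ∈ (extChartAt (𝓡 4) c).source)
    (v : EuclideanSpace ℝ (Fin 4)) : toCoord c m (ofCoord c (extChartAt (𝓡 4) c m) v) = v :=
  mfderiv_extChartAt_apply_symm hm v

lemma LorentzianMetric.coord_apply (c : M) (y u v : EuclideanSpace ℝ (Fin 4)) :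
    g.coord c y u v =
      g.inner ((extChartAt (𝓡 4) c).symm y) (ofCoord c y u) (ofCoord c y v) := rfl

lemma LorentzianMetric.coord_eq_inner {c m : M} (hm : m ∈ (extChartAt (𝓡 4) c).source)
    (u v : EuclideanSpace ℝ (Fin 4)) :
    g.coord c (extChartAt (𝓡 4) c m) u v =
      g.inner m (ofCoord c (extChartAt (𝓡 4) c m) u) (ofCoord c (extChartAt (𝓡 4) c m) v) := by
  rw [g.coord_apply]
  exact congrArg (fun x : M ↦ g.inner x (ofCoord c (extChartAt (𝓡 4) c m) u)
    (ofCoord c (extChartAt (𝓡 4) c m) v)) ((extChartAt (𝓡 4) c).left_inv hm)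

lemma LorentzianMetric.coord_toCoord {c m : M} (hm : m ∈ (extChartAt (𝓡 4) c).source)
    (v w : TangentSpace (𝓡 4) m) :
    g.coord c (extChartAt (𝓡 4) c m) (toCoord c m v) (toCoord c m w) = g.inner m v w := by
  rw [g.coord_eq_inner hm, ofCoord_toCoord hm, ofCoord_toCoord hm]

lemma LorentzianMetric.coord_comm (c : M) (y u v : EuclideanSpace ℝ (Fin 4)) :
    g.coord c y u v = g.coord c y v u := by
  rw [g.coord_apply, g.coord_apply]
  exact g.symm _ _ _

lemma LorentzianMetric.coord_nondegenerate {c m : M} (hm : m ∈ (extChartAt (𝓡 4) c).source)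
    (u : EuclideanSpace ℝ (Fin 4)) (hu : ∀ v, g.coord c (extChartAt (𝓡 4) c m) u v = 0) :
    u = 0 := by
  have h : ofCoord c (extChartAt (𝓡 4) c m) u = 0 := by
    refine g.eq_zero_of_forall (x := m) fun w ↦ ?_
    rw [← hu (toCoord c m w), g.coord_eq_inner hm, ofCoord_toCoord hm]
  rw [← toCoord_ofCoord hm u]
  exact (congrArg (toCoord c m) h).trans (map_zero _)

/-- Tested on constant vectors `u`, `v`: these are the coordinates of smooth local frame fields of
the tangent bundle, on which a smooth metric has smooth values. -/
lemma LorentzianMetric.contDiffAt_coord {c m : M} (hm : m ∈ (extChartAt (𝓡 4) c).source) :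
    ContDiffAt ℝ ∞ (g.coord c) (extChartAt (𝓡 4) c m) := by
  have : IsManifold (𝓡 4) 1 M := IsManifold.of_le (n := ∞) (by simp)
  have hopen := isOpen_extChartAt_target (I := 𝓡 4) c
  suffices ContDiffOn ℝ ∞ (g.coord c) (extChartAt (𝓡 4) c).target from
    this.contDiffAt (hopen.mem_nhds ((extChartAt (𝓡 4) c).map_source hm))
  refine contDiffOn_clm_apply.mpr fun u ↦ contDiffOn_clm_apply.mpr fun v ↦ ?_
  set e := trivializationAt (EuclideanSpace ℝ (Fin 4)) (TangentSpace (𝓡 4)) c with he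
  have hbase : e.baseSet = (chartAt (EuclideanSpace ℝ (Fin 4)) c).source := by simp [e]
  have hsec : ∀ w : EuclideanSpace ℝ (Fin 4), ContMDiffOn (𝓡 4) (𝓡 4).tangent ∞
      (fun x ↦ (⟨x, e.symm x w⟩ : TangentBundle (𝓡 4) M)) e.baseSet := by
    intro w
    refine (e.contMDiffOn_section_baseSet_iff).mpr ?_
    refine (contMDiffOn_const (c := w)).congr fun x hx ↦ ?_
    rw [e.apply_mk_symm hx]
  have h1 : ContMDiffOn (𝓡 4) ((𝓡 4).prod 𝓘(ℝ, ℝ)) ∞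
      (fun x ↦ Bundle.TotalSpace.mk' ℝ (E := Bundle.Trivial M ℝ) x
        (g.inner x (e.symm x u) (e.symm x v))) e.baseSet :=
    g.contMDiff.contMDiffOn.clm_bundle_apply₂ (hsec u) (hsec v)
  have h2 : ContMDiffOn (𝓡 4) 𝓘(ℝ, ℝ) ∞ (fun x ↦ g.inner x (e.symm x u) (e.symm x v)) e.baseSet :=
    fun x hx ↦ ((Bundle.contMDiffWithinAt_totalSpace).mp (h1 x hx)).2
  have h3 := (h2.comp (contMDiffOn_extChartAt_symm (I := 𝓡 4) (n := ∞) c) (fun y hy ↦ by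
    rw [hbase]
    simpa using (extChartAt (𝓡 4) c).map_target hy)).contDiffOn
  refine h3.congr fun y hy ↦ ?_
  have hy' : (extChartAt (𝓡 4) c).symm y ∈ (chartAt (EuclideanSpace ℝ (Fin 4)) c).source := by
    simpa using (extChartAt (𝓡 4) c).map_target hy
  have h4 : ∀ w, e.symm ((extChartAt (𝓡 4) c).symm y) w = ofCoord c y w := by
    intro w
    have h5 := TangentBundle.symmL_trivializationAt (I := 𝓡 4) hy'
    rw [ModelWithCorners.range_eq_univ, mfderivWithin_univ, (extChartAt (𝓡 4) c).right_inv hy] at h5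
    exact (e.symmL_apply (R := ℝ) (by rwa [hbase]) w).symm.trans (DFunLike.congr_fun h5 w)
  simp only [Function.comp_apply, h4]
  rfl

lemma LorentzianMetric.isInvertible_coord {c m : M} (hm : m ∈ (extChartAt (𝓡 4) c).source) :
    (g.coord c (extChartAt (𝓡 4) c m)).IsInvertible :=
  isInvertible_of_nondegenerate (g.coord_nondegenerate hm)

/-- The bundled connection agrees definitionally with the Christoffel symbols of the statement, so
the coordinate calculus applies to them. -/
lemma LorentzianMetric.leviCivita_coord (c : M) (y u v : EuclideanSpace ℝ (Fin 4)) :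
    leviCivita (g.coord c) y u v = g.christoffel c y u v := rfl

lemma LorentzianMetric.curvature_coord (c : M) (y u v w : EuclideanSpace ℝ (Fin 4)) :
    curvature (leviCivita (g.coord c)) y u v w = g.riemannCoord c y u v w := rfl

end Coordinates

/-! ### The hypersurface and its null form in charts. -/

section Immersion

variable {M : Type*} [TopologicalSpace M] [ChartedSpace (EuclideanSpace ℝ (Fin 4)) M]
  {k : ℕ} {N : Type*} [TopologicalSpace N] [ChartedSpace (EuclideanSpace ℝ (Fin k)) N]

/-- The coordinate expression of `ι : N → M` in the charts around `p` and `c`. -/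
def coordMap (ι : N → M) (p : N) (c : M) (z : EuclideanSpace ℝ (Fin k)) :
    EuclideanSpace ℝ (Fin 4) :=
  extChartAt (𝓡 4) c (ι ((extChartAt (𝓡 k) p).symm z))

/-- The coordinates of tangent vectors at `q` in the chart around `p`. -/
def tangentCoord (p q : N) : TangentSpace (𝓡 k) q →L[ℝ] EuclideanSpace ℝ (Fin k) :=
  mfderiv (𝓡 k) 𝓘(ℝ, EuclideanSpace ℝ (Fin k)) (extChartAt (𝓡 k) p) q

/-- The coordinate expression of a vector field in the chart around `p`. -/
def coordField (L : ∀ q : N, TangentSpace (𝓡 k) q) (p : N) (z : EuclideanSpace ℝ (Fin k)) :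
    EuclideanSpace ℝ (Fin k) :=
  tangentCoord p ((extChartAt (𝓡 k) p).symm z) (L ((extChartAt (𝓡 k) p).symm z))

variable {ι : N → M} {L : ∀ q : N, TangentSpace (𝓡 k) q} {p q : N} {c : M}

lemma coordMap_extChartAt (hq : q ∈ (extChartAt (𝓡 k) p).source) :
    coordMap ι p c (extChartAt (𝓡 k) p q) = extChartAt (𝓡 4) c (ι q) := by
  rw [coordMap, (extChartAt (𝓡 k) p).left_inv hq]

lemma coordField_extChartAt (hq : q ∈ (extChartAt (𝓡 k) p).source) :
    coordField L p (extChartAt (𝓡 k) p q) = tangentCoord p q (L q) := by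
  rw [coordField, (extChartAt (𝓡 k) p).left_inv hq]

/-- Coordinate points near that of `q` come from points of `N` lying in both charts, so identities
near a coordinate point can be checked at points of `N`. -/
lemma eventually_mem_source (hι : Continuous ι)
    (hq : q ∈ (extChartAt (𝓡 k) p).source) (hc : ι q ∈ (extChartAt (𝓡 4) c).source) :
    ∀ᶠ z in 𝓝 (extChartAt (𝓡 k) p q), ∃ q' ∈ (extChartAt (𝓡 k) p).source,
      ι q' ∈ (extChartAt (𝓡 4) c).source ∧ extChartAt (𝓡 k) p q' = z := by
  have h1 := (isOpen_extChartAt_target (I := 𝓡 k) p).mem_nhds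
    ((extChartAt (𝓡 k) p).map_source hq)
  have h2 : Filter.Tendsto (extChartAt (𝓡 k) p).symm (𝓝 (extChartAt (𝓡 k) p q)) (𝓝 q) := by
    have := continuousAt_extChartAt_symm' (I := 𝓡 k) hq
    rwa [ContinuousAt, (extChartAt (𝓡 k) p).left_inv hq] at this
  have h3 : ∀ᶠ q' in 𝓝 q, ι q' ∈ (extChartAt (𝓡 4) c).source :=
    hι.continuousAt.eventually ((isOpen_extChartAt_source c).mem_nhds hc)
  filter_upwards [h1, h2.eventually h3] with z hz hz'
  exact ⟨_, (extChartAt (𝓡 k) p).map_target hz, hz', (extChartAt (𝓡 k) p).right_inv hz⟩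

variable [IsManifold (𝓡 4) ∞ M] [IsManifold (𝓡 k) ∞ N] {g : LorentzianMetric M}

lemma tangentCoord_surjective (hq : q ∈ (extChartAt (𝓡 k) p).source) :
    Function.Surjective (tangentCoord (k := k) p q) :=
  fun v ↦ ⟨_, mfderiv_extChartAt_apply_symm hq v⟩

lemma contDiffAt_coordMap (hι : ContMDiff (𝓡 k) (𝓡 4) ∞ ι)
    (hq : q ∈ (extChartAt (𝓡 k) p).source) (hc : ι q ∈ (extChartAt (𝓡 4) c).source) :
    ContDiffAt ℝ ∞ (coordMap ι p c) (extChartAt (𝓡 k) p q) := by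
  have h1 : ContMDiffAt 𝓘(ℝ, EuclideanSpace ℝ (Fin k)) (𝓡 k) ∞ (extChartAt (𝓡 k) p).symm
      (extChartAt (𝓡 k) p q) :=
    (contMDiffOn_extChartAt_symm p).contMDiffAt
      ((isOpen_extChartAt_target p).mem_nhds ((extChartAt (𝓡 k) p).map_source hq))
  have h2 : ContMDiffAt (𝓡 4) 𝓘(ℝ, EuclideanSpace ℝ (Fin 4)) ∞ (extChartAt (𝓡 4) c) (ι q) :=
    contMDiffAt_extChartAt' (by rwa [extChartAt_source] at hc)
  have h3 := h2.comp q hι.contMDiffAt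
  rw [← (extChartAt (𝓡 k) p).left_inv hq] at h3
  exact (h3.comp _ h1).contDiffAt

lemma fderiv_coordMap (hι : ContMDiff (𝓡 k) (𝓡 4) ∞ ι)
    (hq : q ∈ (extChartAt (𝓡 k) p).source) (hc : ι q ∈ (extChartAt (𝓡 4) c).source)
    (X : TangentSpace (𝓡 k) q) :
    fderiv ℝ (coordMap ι p c) (extChartAt (𝓡 k) p q) (tangentCoord p q X) =
      toCoord c (ι q) (mfderiv (𝓡 k) (𝓡 4) ι q X) := by
  have hcd := (contDiffAt_coordMap hι hq hc).differentiableAt (by simp)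
  have hψ : MDifferentiableAt (𝓡 k) 𝓘(ℝ, EuclideanSpace ℝ (Fin k)) (extChartAt (𝓡 k) p) q :=
    (contMDiffAt_extChartAt' (n := ∞) (by rwa [extChartAt_source] at hq)).mdifferentiableAt
      (by simp)
  have hχ : MDifferentiableAt (𝓡 4) 𝓘(ℝ, EuclideanSpace ℝ (Fin 4)) (extChartAt (𝓡 4) c) (ι q) :=
    (contMDiffAt_extChartAt' (n := ∞) (by rwa [extChartAt_source] at hc)).mdifferentiableAt
      (by simp)
  have h1 := mfderiv_comp_apply q hχ (hι.mdifferentiableAt (x := q) (by simp)) X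
  have h2 := mfderiv_comp_apply q hcd.mdifferentiableAt hψ X
  have h3 : coordMap ι p c ∘ extChartAt (𝓡 k) p =ᶠ[𝓝 q] extChartAt (𝓡 4) c ∘ ι := by
    filter_upwards [(isOpen_extChartAt_source p).mem_nhds hq] with q' hq'
    exact coordMap_extChartAt hq'
  rw [h3.mfderiv_eq, mfderiv_eq_fderiv] at h2
  exact h2.symm.trans h1

lemma pullbackMetric_coordMap (hι : ContMDiff (𝓡 k) (𝓡 4) ∞ ι)
    (hq : q ∈ (extChartAt (𝓡 k) p).source) (hc : ι q ∈ (extChartAt (𝓡 4) c).source)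
    (X Y : TangentSpace (𝓡 k) q) :
    pullbackMetric (g.coord c) (coordMap ι p c) (extChartAt (𝓡 k) p q) (tangentCoord p q X)
      (tangentCoord p q Y) = g.induced ι q X Y := by
  rw [pullbackMetric, fderiv_coordMap hι hq hc, fderiv_coordMap hι hq hc, coordMap_extChartAt hq,
    g.coord_toCoord hc, LorentzianMetric.induced]

lemma contDiffAt_coordField
    (hL : ContMDiff (𝓡 k) (𝓡 k).tangent ∞ (fun p ↦ (⟨p, L p⟩ : TangentBundle (𝓡 k) N)))
    (hq : q ∈ (extChartAt (𝓡 k) p).source) :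
    ContDiffAt ℝ ∞ (coordField L p) (extChartAt (𝓡 k) p q) :=
  contDiffAt_coord_field hL hq

/-- A null hypersurface with null tangent field `L`, in coordinates. -/
lemma isNullGerm_coord (hι : ContMDiff (𝓡 k) (𝓡 4) ∞ ι)
    (hL : ContMDiff (𝓡 k) (𝓡 k).tangent ∞ (fun p ↦ (⟨p, L p⟩ : TangentBundle (𝓡 k) N)))
    (hnull : ∀ q Y, g.induced ι q (L q) Y = 0)
    (hq : q ∈ (extChartAt (𝓡 k) p).source) (hc : ι q ∈ (extChartAt (𝓡 4) c).source) :
    IsNullGerm (g.coord c) (leviCivita (g.coord c)) (coordMap ι p c) (coordField L p)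
      (extChartAt (𝓡 k) p q) := by
  have hy := coordMap_extChartAt (ι := ι) (c := c) hq
  have hev : ∀ᶠ y in 𝓝 (extChartAt (𝓡 4) c (ι q)), ∃ m ∈ (extChartAt (𝓡 4) c).source,
      extChartAt (𝓡 4) c m = y := by
    filter_upwards [(isOpen_extChartAt_target (I := 𝓡 4) c).mem_nhds
      ((extChartAt (𝓡 4) c).map_source hc)] with y hy
    exact ⟨_, (extChartAt (𝓡 4) c).map_target hy, (extChartAt (𝓡 4) c).right_inv hy⟩
  have hsymm : ∀ y, ∀ᶠ z in 𝓝 y, ∀ a b, g.coord c z a b = g.coord c z b a :=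
    fun y ↦ Filter.Eventually.of_forall fun z a b ↦ g.coord_comm c z a b
  refine ⟨(contDiffAt_coordMap hι hq hc).of_le ENat.LEInfty.out,
    (contDiffAt_coordField hL hq).of_le ENat.LEInfty.out, ?_, ?_, hsymm _, ?_, ?_, ?_⟩
  · rw [hy]
    exact (g.contDiffAt_coord hc).of_le ENat.LEInfty.out
  · rw [hy]
    exact contDiffAt_leviCivita (g.contDiffAt_coord hc) (g.isInvertible_coord hc)
      (by rw [one_add_one_eq_two]; exact ENat.LEInfty.out)
  · rw [hy]
    filter_upwards [hev] with y hy
    obtain ⟨m, hm, rfl⟩ := hy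
    exact leviCivita_comm ((g.contDiffAt_coord hm).differentiableAt (by simp)) (hsymm _)
  · rw [hy]
    filter_upwards [hev] with y hy
    obtain ⟨m, hm, rfl⟩ := hy
    exact metricCompatible_leviCivita ((g.contDiffAt_coord hm).differentiableAt (by simp))
      (g.isInvertible_coord hm) (hsymm _)
  · filter_upwards [eventually_mem_source hι.continuous hq hc] with z hz w
    obtain ⟨q', hq', hc', rfl⟩ := hz
    obtain ⟨W, rfl⟩ := tangentCoord_surjective hq' w
    rw [coordField_extChartAt hq']
    exact (pullbackMetric_coordMap hι hq' hc' _ _).trans (hnull q' W)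

/-- The null second fundamental form in coordinates. -/
lemma nullForm_eq_coordForm (hι : ContMDiff (𝓡 k) (𝓡 4) ∞ ι)
    (hL : ContMDiff (𝓡 k) (𝓡 k).tangent ∞ (fun p ↦ (⟨p, L p⟩ : TangentBundle (𝓡 k) N)))
    (hq : q ∈ (extChartAt (𝓡 k) p).source) (X Y : TangentSpace (𝓡 k) q) :
    g.nullForm ι (fun q ↦ mfderiv (𝓡 k) (𝓡 4) ι q (L q)) q X Y =
      coordForm (g.coord (ι q)) (leviCivita (g.coord (ι q))) (coordMap ι p (ι q)) (coordField L p)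
        (extChartAt (𝓡 k) p q) (tangentCoord p q X) (tangentCoord p q Y) := by
  -- `covDerivAlong` works in the chart around `ι q`, which forces the target chart here; the source
  -- chart around `p` is free.
  have hc : ι q ∈ (extChartAt (𝓡 4) (ι q)).source := mem_extChartAt_source _
  set V : EuclideanSpace ℝ (Fin k) → EuclideanSpace ℝ (Fin 4) :=
    fun z ↦ fderiv ℝ (coordMap ι p (ι q)) z (coordField L p z) with hV
  have hVd : DifferentiableAt ℝ V (extChartAt (𝓡 k) p q) :=
    ((((contDiffAt_coordMap hι hq hc).of_le (m := 2) ENat.LEInfty.out).fderiv_right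
      (m := 1) (by norm_num)).differentiableAt (by norm_num)).clm_apply
      ((contDiffAt_coordField hL hq).differentiableAt (by simp))
  have hψ : MDifferentiableAt (𝓡 k) 𝓘(ℝ, EuclideanSpace ℝ (Fin k)) (extChartAt (𝓡 k) p) q :=
    (contMDiffAt_extChartAt' (n := ∞) (by rwa [extChartAt_source] at hq)).mdifferentiableAt
      (by simp)
  have hVq : ∀ q' ∈ (extChartAt (𝓡 k) p).source, ι q' ∈ (extChartAt (𝓡 4) (ι q)).source →
      V (extChartAt (𝓡 k) p q') =
        toCoord (ι q) (ι q') (mfderiv (𝓡 k) (𝓡 4) ι q' (L q')) := by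
    intro q' hq' hc'
    simp only [hV]
    rw [coordField_extChartAt hq', fderiv_coordMap hι hq' hc']
  have hev : (fun q' ↦ toCoord (ι q) (ι q') (mfderiv (𝓡 k) (𝓡 4) ι q' (L q'))) =ᶠ[𝓝 q]
      V ∘ extChartAt (𝓡 k) p := by
    have h3 : ∀ᶠ q' in 𝓝 q, ι q' ∈ (extChartAt (𝓡 4) (ι q)).source :=
      hι.continuous.continuousAt.eventually ((isOpen_extChartAt_source _).mem_nhds hc)
    filter_upwards [(isOpen_extChartAt_source p).mem_nhds hq, h3] with q' hq' hc'
    exact (hVq q' hq' hc').symm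
  have hder : mfderiv (𝓡 k) 𝓘(ℝ, EuclideanSpace ℝ (Fin 4))
      (fun q' ↦ toCoord (ι q) (ι q') (mfderiv (𝓡 k) (𝓡 4) ι q' (L q'))) q X =
      fderiv ℝ V (extChartAt (𝓡 k) p q) (tangentCoord p q X) := by
    rw [hev.mfderiv_eq]
    have h2 := mfderiv_comp_apply q hVd.mdifferentiableAt hψ X
    rw [mfderiv_eq_fderiv] at h2
    exact h2
  rw [coordForm, fderiv_coordMap hι hq hc, covAlong, coordMap_extChartAt hq,
    fderiv_coordMap hι hq hc, g.leviCivita_coord, ← hV, coordField_extChartAt hq, fderiv_coordMap hι hq hc, ← hder,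
    LorentzianMetric.nullForm]
  rw [g.coord_eq_inner hc, ofCoord_toCoord hc]
  rfl

end Immersion

/-! ### Tangential null marginal tubes. -/

section Tube

lemma finrank_ker_eq_two {E : Type*} [AddCommGroup E] [Module ℝ E] (hE : Module.finrank ℝ E = 3)
    {f : E →ₗ[ℝ] ℝ} (hf : f ≠ 0) : Module.finrank ℝ (LinearMap.ker f) = 2 := by
  have : FiniteDimensional ℝ E := Module.finite_of_finrank_eq_succ hE
  have h1 := f.finrank_range_add_finrank_ker
  rw [LinearMap.range_eq_top.mpr (LinearMap.surjective hf), finrank_top, Module.finrank_self,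
    hE] at h1
  omega

variable {M : Type*} [TopologicalSpace M] [ChartedSpace (EuclideanSpace ℝ (Fin 4)) M]
  [IsManifold (𝓡 4) ∞ M] {g : LorentzianMetric M}
  {N : Type*} [TopologicalSpace N] [ChartedSpace (EuclideanSpace ℝ (Fin 3)) N]

/-- The metric induced by `ι : N → M`, as a bilinear form. -/
def inducedForm (g : LorentzianMetric M) (ι : N → M) (q : N) :
    LinearMap.BilinForm ℝ (TangentSpace (𝓡 3) q) :=
  LinearMap.mk₂ ℝ (g.induced ι q) (fun _ _ _ ↦ by simp [LorentzianMetric.induced])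
    (fun _ _ _ ↦ by simp [LorentzianMetric.induced])
    (fun _ _ _ ↦ by simp [LorentzianMetric.induced])
    (fun _ _ _ ↦ by simp [LorentzianMetric.induced])

lemma finrank_tangentSpace (q : N) : Module.finrank ℝ (TangentSpace (𝓡 3) q) = 3 :=
  finrank_euclideanSpace_fin (𝕜 := ℝ) (n := 3)

variable {τ : TimeOrientation g} {ι : N → M} {F : Foliation N}

lemma Foliation.finrank_leafTangent (F : Foliation N) (q : N) :
    Module.finrank ℝ (F.leafTangent q) = 2 := by
  obtain ⟨U, -, hqU, f, -, hf⟩ := F.exists_submersion q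
  obtain ⟨h0, h1⟩ := hf q hqU
  rw [h1]
  refine finrank_ker_eq_two (finrank_tangentSpace q) fun h2 ↦ h0 ?_
  ext v
  exact DFunLike.congr_fun h2 v

variable [IsManifold (𝓡 3) ∞ N] {L : ∀ p : N, TangentSpace (𝓡 3) p}

namespace IsTangentialNullMarginalTube

/-- At every point there are a vector in the kernel of the induced metric and an orthonormal frame
of the leaf. -/
lemma exists_frame (h : IsTangentialNullMarginalTube τ ι F L) (q : N) :
    ∃ k e, IsDegenerateFrame (inducedForm g ι q) k e ∧ ∀ A, e A ∈ F.leafTangent q := by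
  have hs : ∀ a b, inducedForm g ι q a b = inducedForm g ι q b a := fun a b ↦ g.symm _ _ _
  obtain ⟨k, hk, hk'⟩ := h.null q
  obtain ⟨e, heW, he⟩ := exists_orthonormal_pair hs (F.finrank_leafTangent q)
    fun a ha h0 ↦ h.marginalTube.spacelike_leaf q a ha h0
  exact ⟨k, e, ⟨hs, hk, hk', he⟩, heW⟩

/-- The induced metric is degenerate and positive on the leaf, hence positive semidefinite, so its
null vector `L q` lies in the kernel. -/
lemma induced_field (h : IsTangentialNullMarginalTube τ ι F L) (q : N)
    (Y : TangentSpace (𝓡 3) q) : g.induced ι q (L q) Y = 0 := by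
  obtain ⟨k, e, hf, -⟩ := h.exists_frame q
  exact hf.null_apply (finrank_tangentSpace q) (h.futureNull q).1.2 Y

lemma field_ne_zero (h : IsTangentialNullMarginalTube τ ι F L) (q : N) : L q ≠ 0 := by
  intro h0
  apply (h.futureNull q).1.1
  rw [push, h0, map_zero]

lemma isNullGerm (h : IsTangentialNullMarginalTube τ ι F L) {p q : N} {c : M}
    (hq : q ∈ (extChartAt (𝓡 3) p).source) (hc : ι q ∈ (extChartAt (𝓡 4) c).source) :
    IsNullGerm (g.coord c) (leviCivita (g.coord c)) (coordMap ι p c) (coordField L p)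
      (extChartAt (𝓡 3) p q) :=
  isNullGerm_coord h.marginalTube.smooth h.smooth h.induced_field hq hc

/-- The null second fundamental form can be computed in any chart. -/
lemma nullForm_eq_coordForm (h : IsTangentialNullMarginalTube τ ι F L) {p q : N} {c : M}
    (hq : q ∈ (extChartAt (𝓡 3) p).source) (hc : ι q ∈ (extChartAt (𝓡 4) c).source)
    (X Y : TangentSpace (𝓡 3) q) :
    g.nullForm ι (push ι L) q X Y =
      coordForm (g.coord c) (leviCivita (g.coord c)) (coordMap ι p c) (coordField L p)
        (extChartAt (𝓡 3) p q) (tangentCoord p q X) (tangentCoord p q Y) := by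
  have hι := h.marginalTube.smooth
  have hc' : ι q ∈ (extChartAt (𝓡 4) (ι q)).source := mem_extChartAt_source _
  refine (NullTube.nullForm_eq_coordForm hι h.smooth hq X Y).trans ?_
  -- The target charts around `ι q` and around `c` both express the same induced metric.
  refine (h.isNullGerm hq hc').coordForm_congr (h.isNullGerm hq hc) ?_ _ _
  filter_upwards [eventually_mem_source hι.continuous hq hc,
    eventually_mem_source hι.continuous hq hc'] with z hz hz' u v
  obtain ⟨q₁, hq₁, hc₁, rfl⟩ := hz
  obtain ⟨q₂, hq₂, hc₂, heq⟩ := hz'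
  obtain rfl : q₂ = q₁ := (extChartAt (𝓡 3) p).injOn hq₂ hq₁ heq
  obtain ⟨X, rfl⟩ := tangentCoord_surjective hq₁ u
  obtain ⟨Y, rfl⟩ := tangentCoord_surjective hq₁ v
  rw [pullbackMetric_coordMap hι hq₁ hc₁, pullbackMetric_coordMap hι hq₁ hc₂]

/-- The vanishing of the expansion, as an identity between arbitrary pairs of tangent vectors. -/
lemma polarized_expansion (h : IsTangentialNullMarginalTube τ ι F L) (q : N)
    (X Y : TangentSpace (𝓡 3) q) :
    g.induced ι q Y Y * g.nullForm ι (push ι L) q X X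
      - 2 * (g.induced ι q X Y * g.nullForm ι (push ι L) q X Y)
      + g.induced ι q X X * g.nullForm ι (push ι L) q Y Y = 0 := by
  have hq : q ∈ (extChartAt (𝓡 3) q).source := mem_extChartAt_source _
  have hc : ι q ∈ (extChartAt (𝓡 4) (ι q)).source := mem_extChartAt_source _
  have hgerm := h.isNullGerm hq hc
  have hform := h.nullForm_eq_coordForm hq hc
  obtain ⟨k, e, hf, heW⟩ := h.exists_frame q
  have hL : IsDegenerateFrame (inducedForm g ι q) (L q) e :=
    ⟨hf.symm, h.field_ne_zero q, h.induced_field q, hf.orthonormal⟩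
  let B : LinearMap.BilinForm ℝ (TangentSpace (𝓡 3) q) :=
    LinearMap.mk₂ ℝ (g.nullForm ι (push ι L) q)
      (fun _ _ _ ↦ by simp only [hform, coordForm, covAlong_add, map_add, add_apply])
      (fun _ _ _ ↦ by simp only [hform, coordForm, covAlong_smul, map_smul, smul_apply])
      (fun _ _ _ ↦ by simp only [hform, coordForm, map_add])
      (fun _ _ _ ↦ by simp only [hform, coordForm, map_smul])
  have hB : ∀ X Y, B X Y = g.nullForm ι (push ι L) q X Y := fun _ _ ↦ rfl
  have := hL.polarized_trace (finrank_tangentSpace q) (B := B)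
    (fun u v ↦ by rw [hB, hB, hform, hform, hgerm.coordForm_comm])
    (fun u ↦ by rw [hB, hform, ← coordField_extChartAt hq, hgerm.coordForm_field_left])
    (h.expansion q e heW hf.orthonormal) X Y
  exact this

/-- The Raychaudhuri equation: `Ric(L, L) = -|χ|²`. -/
theorem ricci_eq (h : IsTangentialNullMarginalTube τ ι F L) (p : N)
    (e : Fin 2 → TangentSpace (𝓡 3) p) (he : g.IsSpacelikeFrame ι p e) :
    g.ricci (ι p) (push ι L p) (push ι L p) =
      - ∑ A, ∑ B, g.nullForm ι (push ι L) p (e A) (e B) ^ 2 := by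
  have hι := h.marginalTube.smooth
  have hp : p ∈ (extChartAt (𝓡 3) p).source := mem_extChartAt_source _
  have hc : ι p ∈ (extChartAt (𝓡 4) (ι p)).source := mem_extChartAt_source _
  have hgerm := h.isNullGerm hp hc
  have hF : Module.finrank ℝ (EuclideanSpace ℝ (Fin 4)) = 4 := finrank_euclideanSpace_fin
  have hl : fderiv ℝ (coordMap ι p (ι p)) (extChartAt (𝓡 3) p p)
      (coordField L p (extChartAt (𝓡 3) p p)) = toCoord (ι p) (ι p) (push ι L p) := by
    rw [coordField_extChartAt hp, fderiv_coordMap hι hp hc, push]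
  have hy : coordMap ι p (ι p) (extChartAt (𝓡 3) p p) = extChartAt (𝓡 4) (ι p) (ι p) :=
    coordMap_extChartAt hp
  have hf : IsNullFrame (g.coord (ι p) (coordMap ι p (ι p) (extChartAt (𝓡 3) p p)))
      (fderiv ℝ (coordMap ι p (ι p)) (extChartAt (𝓡 3) p p)
        (coordField L p (extChartAt (𝓡 3) p p)))
      (fun A ↦ fderiv ℝ (coordMap ι p (ι p)) (extChartAt (𝓡 3) p p) (tangentCoord p p (e A))) := by
    refine ⟨fun a b ↦ g.coord_comm _ _ a b, ?_, ?_, ?_, ?_, ?_⟩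
    · rw [hy]
      exact g.coord_nondegenerate hc
    · rw [hl]
      intro h0
      apply (h.futureNull p).1.1
      rw [← ofCoord_toCoord hc (push ι L p), h0]
      exact map_zero _
    · exact hgerm.null.self_of_nhds _
    · exact fun A ↦ hgerm.null.self_of_nhds _
    · exact fun A B ↦ (pullbackMetric_coordMap hι hp hc (e A) (e B)).trans (he A B)
  have htr : ∀ᶠ z in 𝓝 (extChartAt (𝓡 3) p p), ∀ u v,
      pullbackMetric (g.coord (ι p)) (coordMap ι p (ι p)) z v v *
          coordForm (g.coord (ι p)) (leviCivita (g.coord (ι p))) (coordMap ι p (ι p))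
            (coordField L p) z u u
        - 2 * (pullbackMetric (g.coord (ι p)) (coordMap ι p (ι p)) z u v *
          coordForm (g.coord (ι p)) (leviCivita (g.coord (ι p))) (coordMap ι p (ι p))
            (coordField L p) z u v)
        + pullbackMetric (g.coord (ι p)) (coordMap ι p (ι p)) z u u *
          coordForm (g.coord (ι p)) (leviCivita (g.coord (ι p))) (coordMap ι p (ι p))
            (coordField L p) z v v = 0 := by
    filter_upwards [eventually_mem_source hι.continuous hp hc] with z hz u v
    obtain ⟨q, hq, hcq, rfl⟩ := hz
    obtain ⟨X, rfl⟩ := tangentCoord_surjective hq u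
    obtain ⟨Y, rfl⟩ := tangentCoord_surjective hq v
    -- Here `q` varies while the charts around `p` and `ι p` stay fixed. The identity involves
    -- arbitrary `X`, `Y`, so the frame `e` need not be tangent to the leaf.
    have := h.polarized_expansion q X Y
    rw [h.nullForm_eq_coordForm hq hcq, h.nullForm_eq_coordForm hq hcq,
      h.nullForm_eq_coordForm hq hcq] at this
    rwa [pullbackMetric_coordMap hι hq hcq, pullbackMetric_coordMap hι hq hcq,
      pullbackMetric_coordMap hι hq hcq]
  have h1 := hgerm.sum_curvature hF hf htr
  have h2 := trace_curvature (EuclideanSpace.basisFun (Fin 4) ℝ).toBasis hf hF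
    hgerm.contDiffAt_metric hgerm.contDiffAt_connection hgerm.compatible
  rw [← h2, hl, hy] at h1
  simp only [h.nullForm_eq_coordForm hp hc]
  rw [← h1, LorentzianMetric.ricci]
  refine Finset.sum_congr rfl fun i _ ↦ ?_
  simp [g.curvature_coord]

end IsTangentialNullMarginalTube

end Tube

end NullTube

end

/-! ### Conclusion from null convergence. -/

theorem mainTheorem5 {M : Type*} [TopologicalSpace M] [ChartedSpace (EuclideanSpace ℝ (Fin 4)) M]
    [IsManifold (𝓡 4) ∞ M] (g : NullTube.LorentzianMetric M) (τ : NullTube.TimeOrientation g)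
    (hg : g.NullConvergence)
    {N : Type*} [TopologicalSpace N] [ChartedSpace (EuclideanSpace ℝ (Fin 3)) N] [IsManifold (𝓡 3) ∞ N]
    (ι : N → M) (F : NullTube.Foliation N) (L : ∀ p : N, TangentSpace (𝓡 3) p)
    (h : NullTube.IsTangentialNullMarginalTube τ ι F L) :
    NullTube.IsShearFree g ι L := by
  intro p e he
  have h1 := hg (ι p) (NullTube.push ι L p) (h.futureNull p).1
  rw [h.ricci_eq p e he] at h1
  have h2 : ∀ A B, g.nullForm ι (NullTube.push ι L) p (e A) (e B) = 0 := by
    -- `h1` now says that minus this sum of squares is nonnegative.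
    have h3 : ∑ A, ∑ B, g.nullForm ι (NullTube.push ι L) p (e A) (e B) ^ 2 = 0 :=
      le_antisymm (by linarith) (Finset.sum_nonneg fun A _ ↦ Finset.sum_nonneg fun B _ ↦ sq_nonneg _)
    intro A B
    rw [Finset.sum_eq_zero_iff_of_nonneg
      fun A _ ↦ Finset.sum_nonneg fun B _ ↦ sq_nonneg _] at h3
    have h4 := h3 A (Finset.mem_univ A)
    rw [Finset.sum_eq_zero_iff_of_nonneg fun B _ ↦ sq_nonneg _] at h4
    exact pow_eq_zero_iff two_ne_zero |>.mp (h4 B (Finset.mem_univ B))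
  intro A B
  simp [NullTube.LorentzianMetric.shear, NullTube.LorentzianMetric.nullExpansion, h2]
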